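/- **Setting.** All Hilbert spaces are complex. A *bipartitioned layered holographic network* (with boundary region $A$ and complement $A^c$) consists of the following data, for layers $\Lambda=0,1,2,\dots$ (in the paper these are obtained from the opened-up HaPPY code). * Side $A$: finite-dimensional Hilbert spaces $\mathcal H_A^\Lambda$ (boundary), $\mathcal H_{\delta a}^\Lambda$ (new bulk legs), $\mathcal H_{\chi_{\delta a}}^\Lambda$ (new auxiliary legs), $\mathcal H_{\delta\gamma_A}^\Lambda$ (new RT-surface legs); unitaries $$U_A^{0}:\mathcal H_{\delta a}^{0}\otimes\mathcal H_{\chi_{\delta a}}^{0}\otimes\mathcal H_{\delta\gamma_A}^{0}\to\mathcal H_A^{0},\qquad U_A^{\Lambda,\Lambda+1}:\mathcal H_A^\Lambda\otimes\mathcal H_{\delta a}^{\Lambda+1}\otimes\mathcal H_{\chi_{\delta a}}^{\Lambda+1}\otimes\mathcal H_{\delta\gamma_A}^{\Lambda+1}\to\mathcal H_A^{\Lambda+1};$$ and unit vectors $|i_{\delta a}\rangle^\Lambda\in\mathcal H_{\delta a}^\Lambda$, $|\chi_{\delta a}\rangle^\Lambda\in\mathcal H_{\chi_{\delta a}}^\Lambda$.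 * Side $A^c$: data of the same kind, with bulk vectors denoted $|j_{\delta a^c}\rangle^\Lambda$. * For every $\Lambda$, a maximally entangled vector $|\chi_{\delta\gamma}\rangle^\Lambda=d^{-1/2}\sum_{k=1}^{d}e_k\otimes f_k\in\mathcal H_{\delta\gamma_A}^\Lambda\otimes\mathcal H_{\delta\gamma_{A^c}}^\Lambda$, where $(e_k)$, $(f_k)$ are orthonormal bases of the two factors and $d=d_\Lambda\ge1$ is their common dimension. Put $\mathcal H^\Lambda=\mathcal H_A^\Lambda\otimes\mathcal H_{A^c}^\Lambda$. The layer isometries are $$\gamma^{\Lambda,\Lambda+1}\psi=U_A^{\Lambda,\Lambda+1}U_{A^c}^{\Lambda,\Lambda+1}\bigl(\psi\otimes|i_{\delta a}\rangle|\chi_{\delta a}\rangle|\chi_{\delta\gamma}\rangle|j_{\delta a^c}\rangle|\chi_{\delta a^c}\rangle\bigr)$$ (vectors of layer $\Lambda+1$). The network states are $\Psi^0=U_A^0U_{A^c}^0(|i_{\delta a}\rangle|\chi_{\delta a}\rangle|\chi_{\delta\gamma}\rangle|j_{\delta a^c}\rangle|\chi_{\delta a^c}\rangle)$ (vectors of layer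 $0$) and $\Psi^{\Lambda+1}=\gamma^{\Lambda,\Lambda+1}\Psi^\Lambda$. Operator pushing is $\phi^{\Lambda,\Lambda+1}(O)=U_A^{\Lambda,\Lambda+1}(O\otimes 1)U_A^{\Lambda,\Lambda+1\,\dagger}$ for $O\in\mathcal B(\mathcal H_A^\Lambda)$. Let $\mathcal H$ be the inductive-limit Hilbert space of $(\mathcal H^\Lambda,\gamma^{\Lambda,\Lambda+1})$, i.e. the completion of the space of classes $[\psi]$, $\psi\in\mathcal H^\Lambda$, and let $\Psi=[\Psi^\Lambda]\in\mathcal H$ (it does not depend on $\Lambda$). For $O\in\mathcal B(\mathcal H_A^\Lambda)$ let $\pi([O])$ be the bounded operator on $\mathcal H$ with $\pi([O])[\psi]=[(\phi^{\Lambda,\Lambda'}(O)\otimes1_{A^c})\psi]$ for $\Lambda'\ge\Lambda$ and $\psi\in\mathcal H^{\Lambda'}$, where $\phi^{\Lambda,\Lambda'}$ is the composition of the layer-to-layer pushing maps. The RT algebra $\mathcal A_{\gamma_A}^\Lambda\subseteq\mathcal B(\mathcal H_A^\Lambda)$ is the $*$-algebra generated by all operators on the RT legs $\mathcal H_{\delta\gamma_A}^{k}$,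 $k\le\Lambda$, carried to layer $\Lambda$: $\mathcal A_{\gamma_A}^0=U_A^0(1\otimes1\otimes\mathcal B(\mathcal H^0_{\delta\gamma_A}))U_A^{0\dagger}$, and $\mathcal A_{\gamma_A}^{\Lambda+1}$ is generated by $\phi^{\Lambda,\Lambda+1}(\mathcal A_{\gamma_A}^\Lambda)$ and $U_A^{\Lambda,\Lambda+1}(1\otimes1\otimes1\otimes\mathcal B(\mathcal H^{\Lambda+1}_{\delta\gamma_A}))U_A^{\Lambda,\Lambda+1\,\dagger}$. Let $\pi(\hat{\mathcal A}_{\gamma_A})$ be the norm closure of $\bigcup_\Lambda\pi([\mathcal A_{\gamma_A}^\Lambda])$, which is the inductive-limit C*-algebra $\hat{\mathcal A}_{\gamma_A}=\varinjlim\mathcal A_{\gamma_A}^\Lambda$ represented on $\mathcal H$, and let $\mathcal A_{\gamma_A}=\pi(\hat{\mathcal A}_{\gamma_A})''$. **Theorem 1.** Assume that $\dim\mathcal H_{\delta\gamma_A}^\Lambda\ge2$ for infinitely many $\Lambda$ (the RT surface is extended by a nontrivial entangled pair infinitely often). Then the inductive-limit RT von Neumann algebra $\mathcal A_{\gamma_A}$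 has type $\mathrm{II}_1$ (it is nonzero, finite, and has no nonzero abelian projection), and it is a factor. Moreover, $x\mapsto\langle\Psi,x\Psi\rangle$ is a tracial state on $\pi(\hat{\mathcal A}_{\gamma_A})$, and on $\mathcal A_{\gamma_A}$ the same formula defines a normal tracial state. -/

import Mathlib

open scoped TensorProduct

universe u v

noncomputable section

/-! ## Inductive limits of Hilbert spaces -/

section HilbertLimit

variable {V : ℕ → Type u} [∀ n, NormedAddCommGroup (V n)] [∀ n, InnerProductSpace ℂ (V n)]

/-- The multi-layer isometry `γ^{m,n} : V m → V n` (for `m ≤ n`) composed of the layer-to-layer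
isometries `γ n : V n → V (n + 1)`. -/
def multiStep (γ : ∀ n, V n →ₗᵢ[ℂ] V (n + 1)) (m n : ℕ) (h : m ≤ n) : V m →ₗᵢ[ℂ] V n :=
  Nat.leRec (motive := fun k _ => V m →ₗᵢ[ℂ] V k) LinearIsometry.id
    (fun k _ f => (γ k).comp f) h

variable (γ : ∀ n, V n →ₗᵢ[ℂ] V (n + 1))

theorem multiStep_self (m : ℕ) (x : V m) : multiStep γ m m le_rfl x = x := by
  simp [multiStep, Nat.leRec_self]

theorem multiStep_succ (m n : ℕ) (h : m ≤ n) (x : V m) :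
    multiStep γ m (n + 1) (h.trans n.le_succ) x = γ n (multiStep γ m n h x) := by
  simp [multiStep, Nat.leRec_succ _ _ h]

theorem multiStep_trans (k m n : ℕ) (hkm : k ≤ m) (hmn : m ≤ n) (x : V k) :
    multiStep γ m n hmn (multiStep γ k m hkm x) = multiStep γ k n (hkm.trans hmn) x := by
  induction n, hmn using Nat.le_induction with
  | base => rw [multiStep_self]
  | succ n hmn ih => rw [multiStep_succ γ m n hmn, ih, ← multiStep_succ]

instance multiStep_directedSystem : DirectedSystem V (multiStep γ · · ·) where
  map_self i x := multiStep_self γ i x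
  map_map k j i hij hjk x := multiStep_trans γ i j k hij hjk x

/-- The space of equivalence classes `[ψ]` of vectors `ψ ∈ V n`, where `ψ` is identified with all
its images under the isometries. -/
def PreHilbertLimit (γ : ∀ n, V n →ₗᵢ[ℂ] V (n + 1)) : Type u := DirectLimit V (multiStep γ)

instance : AddCommGroup (PreHilbertLimit γ) :=
  inferInstanceAs (AddCommGroup (DirectLimit V (multiStep γ)))

instance : Module ℂ (PreHilbertLimit γ) :=
  inferInstanceAs (Module ℂ (DirectLimit V (multiStep γ)))

/-- The map `ψ ↦ [ψ]` on `V n`. -/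
def PreHilbertLimit.of (n : ℕ) : V n →ₗ[ℂ] PreHilbertLimit γ :=
  DirectLimit.Module.of ℂ ℕ V (multiStep γ) n

variable {γ} in
theorem PreHilbertLimit.of_multiStep (m n : ℕ) (h : m ≤ n) (x : V m) :
    PreHilbertLimit.of γ n (multiStep γ m n h x) = PreHilbertLimit.of γ m x :=
  DirectLimit.Module.of_f

variable {γ} in
theorem PreHilbertLimit.of_step (n : ℕ) (x : V n) :
    PreHilbertLimit.of γ (n + 1) (γ n x) = PreHilbertLimit.of γ n x := by
  rw [← PreHilbertLimit.of_multiStep n (n + 1) n.le_succ, multiStep_succ γ n n le_rfl,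
    multiStep_self]

variable {γ} in
theorem PreHilbertLimit.induction {C : PreHilbertLimit γ → Prop}
    (h : ∀ n x, C (PreHilbertLimit.of γ n x)) (z : PreHilbertLimit γ) : C z :=
  DirectLimit.induction (multiStep γ) h z

variable {γ} in
theorem PreHilbertLimit.induction₂ {C : PreHilbertLimit γ → PreHilbertLimit γ → Prop}
    (h : ∀ n x y, C (PreHilbertLimit.of γ n x) (PreHilbertLimit.of γ n y))
    (z w : PreHilbertLimit γ) : C z w :=
  DirectLimit.induction₂ (multiStep γ) h z w

variable {γ} in
theorem PreHilbertLimit.induction₃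
    {C : PreHilbertLimit γ → PreHilbertLimit γ → PreHilbertLimit γ → Prop}
    (h : ∀ n x y t, C (PreHilbertLimit.of γ n x) (PreHilbertLimit.of γ n y)
      (PreHilbertLimit.of γ n t)) (z w t : PreHilbertLimit γ) : C z w t :=
  DirectLimit.induction₃ (multiStep γ) h z w t

variable {γ} in
theorem PreHilbertLimit.induction_ge (m : ℕ) {C : PreHilbertLimit γ → Prop}
    (h : ∀ n, m ≤ n → ∀ x, C (PreHilbertLimit.of γ n x)) (z : PreHilbertLimit γ) : C z := by
  induction z using PreHilbertLimit.induction with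
  | h n x =>
    rw [← PreHilbertLimit.of_multiStep n (max m n) (le_max_right m n)]
    exact h _ (le_max_left m n) _

/-- The inner product `⟨[ψ], [φ]⟩`, computed on representatives in a common layer. -/
instance : Inner ℂ (PreHilbertLimit γ) where
  inner := DirectLimit.lift₂ (multiStep γ) (multiStep γ) (fun _ x y => inner ℂ x y)
    (fun i j h x y => ((multiStep γ i j h).inner_map_map x y).symm)

theorem PreHilbertLimit.inner_of (n : ℕ) (x y : V n) :
    inner ℂ (PreHilbertLimit.of γ n x) (PreHilbertLimit.of γ n y) = inner ℂ x y :=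
  DirectLimit.lift₂_def (multiStep γ) (multiStep γ) _ _ n x y

instance PreHilbertLimit.core : InnerProductSpace.Core ℂ (PreHilbertLimit γ) where
  conj_inner_symm := PreHilbertLimit.induction₂ fun n x y => by
    simp only [PreHilbertLimit.inner_of, inner_conj_symm]
  re_inner_nonneg := PreHilbertLimit.induction fun n x => by
    simp only [PreHilbertLimit.inner_of]
    exact inner_self_nonneg
  add_left := PreHilbertLimit.induction₃ fun n x y t => by
    simp only [← map_add, PreHilbertLimit.inner_of, inner_add_left]
  smul_left := PreHilbertLimit.induction₂ fun n x y r => by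
    simp only [← map_smul, PreHilbertLimit.inner_of, inner_smul_left]
  definite := PreHilbertLimit.induction fun n x h => by
    rw [PreHilbertLimit.inner_of, inner_self_eq_zero] at h
    rw [h, map_zero]

instance : NormedAddCommGroup (PreHilbertLimit γ) :=
  InnerProductSpace.Core.toNormedAddCommGroup (cd := PreHilbertLimit.core γ)

instance : InnerProductSpace ℂ (PreHilbertLimit γ) :=
  InnerProductSpace.ofCore (PreHilbertLimit.core γ).toCore

theorem PreHilbertLimit.norm_of (n : ℕ) (x : V n) : ‖PreHilbertLimit.of γ n x‖ = ‖x‖ := by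
  rw [@norm_eq_sqrt_re_inner ℂ, @norm_eq_sqrt_re_inner ℂ]
  exact congrArg (fun z : ℂ => √(RCLike.re z)) (PreHilbertLimit.inner_of γ n x x)

/-- The inductive limit Hilbert space of `V 0 → V 1 → ⋯`: the completion of the space of
equivalence classes. -/
abbrev HilbertLimit (γ : ∀ n, V n →ₗᵢ[ℂ] V (n + 1)) : Type u :=
  UniformSpace.Completion (PreHilbertLimit γ)

/-- The canonical isometry `ψ ↦ [ψ]` of `V n` into the inductive limit Hilbert space. -/
def HilbertLimit.of (n : ℕ) : V n →ₗᵢ[ℂ] HilbertLimit γ :=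
  UniformSpace.Completion.toComplₗᵢ.comp
    { PreHilbertLimit.of γ n with norm_map' := PreHilbertLimit.norm_of γ n }

theorem HilbertLimit.of_apply (n : ℕ) (x : V n) :
    HilbertLimit.of γ n x = ((PreHilbertLimit.of γ n x : PreHilbertLimit γ) : HilbertLimit γ) :=
  rfl

theorem HilbertLimit.of_step (n : ℕ) (x : V n) :
    HilbertLimit.of γ (n + 1) (γ n x) = HilbertLimit.of γ n x := by
  simp only [HilbertLimit.of_apply, PreHilbertLimit.of_step]

variable {γ} in
theorem HilbertLimit.clm_ext (m : ℕ) {S T : HilbertLimit γ →L[ℂ] HilbertLimit γ}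
    (h : ∀ n, m ≤ n → ∀ ψ : V n, S (HilbertLimit.of γ n ψ) = T (HilbertLimit.of γ n ψ)) :
    S = T := by
  ext z
  induction z using UniformSpace.Completion.induction_on with
  | hp => exact isClosed_eq S.continuous T.continuous
  | ih z =>
    exact PreHilbertLimit.induction_ge (C := fun z => S (z : HilbertLimit γ) = T z) m
      (fun n hn x => h n hn x) z

end HilbertLimit

/-! ## Representation of an inductive system of algebras on the limit Hilbert space -/

section LimitRep

variable {V : ℕ → Type u} [∀ n, NormedAddCommGroup (V n)] [∀ n, InnerProductSpace ℂ (V n)]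
  [∀ n, CompleteSpace (V n)]
variable {B : ℕ → Type v} [∀ n, CStarAlgebra (B n)]

/-- The multi-layer operator pushing map `φ^{m,n} : B m → B n` (for `m ≤ n`) composed of the
layer-to-layer maps. -/
def multiPush (φ : ∀ n, B n →⋆ₐ[ℂ] B (n + 1)) (m n : ℕ) (h : m ≤ n) : B m →⋆ₐ[ℂ] B n :=
  Nat.leRec (motive := fun k _ => B m →⋆ₐ[ℂ] B k) (StarAlgHom.id ℂ (B m))
    (fun k _ f => (φ k).comp f) h

theorem multiPush_self (φ : ∀ n, B n →⋆ₐ[ℂ] B (n + 1)) (m : ℕ) (b : B m) :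
    multiPush φ m m le_rfl b = b := by
  simp [multiPush, Nat.leRec_self]

theorem multiPush_succ (φ : ∀ n, B n →⋆ₐ[ℂ] B (n + 1)) (m n : ℕ) (h : m ≤ n) (b : B m) :
    multiPush φ m (n + 1) (h.trans n.le_succ) b = φ n (multiPush φ m n h b) := by
  simp [multiPush, Nat.leRec_succ _ _ h]

/-- An inductive system of algebras `B n` acting on an inductive system of Hilbert spaces `V n`:
unital `*`-homomorphisms `φ n` (operator pushing), representations `ρ n` on `V n`, and the
compatibility `φ(b) γ ψ = γ (b ψ)` of operator pushing with the isometries. -/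
structure RepSystem (γ : ∀ n, V n →ₗᵢ[ℂ] V (n + 1)) (B : ℕ → Type v)
    [∀ n, CStarAlgebra (B n)] where
  φ : ∀ n, B n →⋆ₐ[ℂ] B (n + 1)
  ρ : ∀ n, B n →⋆ₐ[ℂ] (V n →L[ℂ] V n)
  compat : ∀ n b ψ, ρ (n + 1) (φ n b) (γ n ψ) = γ n (ρ n b ψ)

variable {γ : ∀ n, V n →ₗᵢ[ℂ] V (n + 1)} (S : RepSystem γ B)

namespace RepSystem

theorem compat_multi (k m n : ℕ) (hkm : k ≤ m) (hmn : m ≤ n) (b : B k) (ψ : V m) :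
    S.ρ n (multiPush S.φ k n (hkm.trans hmn) b) (multiStep γ m n hmn ψ) =
      multiStep γ m n hmn (S.ρ m (multiPush S.φ k m hkm b) ψ) := by
  induction n, hmn using Nat.le_induction with
  | base => simp only [multiStep_self]
  | succ n hmn ih =>
    rw [multiStep_succ γ m n hmn, multiPush_succ S.φ k n (hkm.trans hmn), S.compat, ih,
      ← multiStep_succ]

/-- The operator `[ψ] ↦ [φ^{m,k}(b) γ^{n,k} ψ]`, `k = max m n`, for `b ∈ B m` and `ψ ∈ V n`. -/
def preLin (m : ℕ) (b : B m) : PreHilbertLimit γ →ₗ[ℂ] PreHilbertLimit γ :=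
  DirectLimit.Module.lift ℂ ℕ V (multiStep γ)
    (fun n => PreHilbertLimit.of γ (max m n) ∘ₗ
      (S.ρ (max m n) (multiPush S.φ m (max m n) (le_max_left m n) b)).toLinearMap ∘ₗ
      (multiStep γ n (max m n) (le_max_right m n)).toLinearMap)
    (fun i j hij x => by
      have h : max m i ≤ max m j := max_le_max le_rfl hij
      have h1 := S.compat_multi m (max m i) (max m j) (le_max_left m i) h b
        (multiStep γ i (max m i) (le_max_right m i) x)
      rw [multiStep_trans] at h1
      simp only [LinearMap.comp_apply, ContinuousLinearMap.coe_coe,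
        LinearIsometry.coe_toLinearMap, multiStep_trans]
      rw [h1, PreHilbertLimit.of_multiStep])

theorem preLin_of (m n : ℕ) (h : m ≤ n) (b : B m) (ψ : V n) :
    S.preLin m b (PreHilbertLimit.of γ n ψ) =
      PreHilbertLimit.of γ n (S.ρ n (multiPush S.φ m n h b) ψ) := by
  have h1 := S.compat_multi m n (max m n) h (le_max_right m n) b ψ
  have h2 : S.preLin m b (PreHilbertLimit.of γ n ψ) = PreHilbertLimit.of γ (max m n)
    (S.ρ (max m n) (multiPush S.φ m (max m n) (le_max_left m n) b)
      (multiStep γ n (max m n) (le_max_right m n) ψ)) := rfl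
  rw [h2, h1, PreHilbertLimit.of_multiStep]

theorem norm_preLin_le (m : ℕ) (b : B m) (z : PreHilbertLimit γ) :
    ‖S.preLin m b z‖ ≤ ‖b‖ * ‖z‖ := by
  refine PreHilbertLimit.induction_ge (C := fun z => ‖S.preLin m b z‖ ≤ ‖b‖ * ‖z‖) m
    (fun n hn x => ?_) z
  · rw [S.preLin_of m n hn, PreHilbertLimit.norm_of, PreHilbertLimit.norm_of]
    refine ((S.ρ n _).le_opNorm x).trans ?_
    gcongr
    exact (NonUnitalStarAlgHom.norm_apply_le (S.ρ n) _).trans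
      (NonUnitalStarAlgHom.norm_apply_le (multiPush S.φ m n hn) b)

/-- `preLin` as a bounded operator. -/
def preCLM (m : ℕ) (b : B m) : PreHilbertLimit γ →L[ℂ] PreHilbertLimit γ :=
  (S.preLin m b).mkContinuous ‖b‖ (S.norm_preLin_le m b)

theorem preCLM_of (m n : ℕ) (h : m ≤ n) (b : B m) (ψ : V n) :
    S.preCLM m b (PreHilbertLimit.of γ n ψ) =
      PreHilbertLimit.of γ n (S.ρ n (multiPush S.φ m n h b) ψ) :=
  S.preLin_of m n h b ψ

theorem completion_of (m n : ℕ) (h : m ≤ n) (b : B m) (ψ : V n) :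
    (S.preCLM m b).completion (HilbertLimit.of γ n ψ) =
      HilbertLimit.of γ n (S.ρ n (multiPush S.φ m n h b) ψ) := by
  rw [HilbertLimit.of_apply, ContinuousLinearMap.completion_apply_coe, S.preCLM_of m n h,
    HilbertLimit.of_apply]

/-- The representation `π` of the layer-`m` algebra on the inductive limit Hilbert space:
`π([b]) [ψ] = [φ^{m,n}(b) ψ]` for `ψ ∈ V n`, `m ≤ n`, extended by continuity. -/
def limitRep (m : ℕ) : B m →⋆ₐ[ℂ] (HilbertLimit γ →L[ℂ] HilbertLimit γ) where
  toFun b := (S.preCLM m b).completion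
  map_one' := HilbertLimit.clm_ext m fun n hn ψ => by
    rw [S.completion_of m n hn, map_one, map_one]; rfl
  map_mul' b c := HilbertLimit.clm_ext m fun n hn ψ => by
    rw [S.completion_of m n hn, map_mul, map_mul, mul_apply_eq_comp,
      mul_apply_eq_comp, S.completion_of m n hn, S.completion_of m n hn]
  map_zero' := HilbertLimit.clm_ext m fun n hn ψ => by
    rw [S.completion_of m n hn, map_zero, map_zero]
    simp
  map_add' b c := HilbertLimit.clm_ext m fun n hn ψ => by
    rw [S.completion_of m n hn, map_add, map_add, add_apply,
      add_apply, S.completion_of m n hn, S.completion_of m n hn, map_add]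
  commutes' r := HilbertLimit.clm_ext m fun n hn ψ => by
    rw [S.completion_of m n hn, AlgHomClass.commutes, AlgHomClass.commutes]
    simp [Algebra.algebraMap_eq_smul_one]
  map_star' b := by
    refine (ContinuousLinearMap.eq_adjoint_iff _ _).mpr fun x y => ?_
    induction x, y using UniformSpace.Completion.induction_on₂ with
    | hp => apply isClosed_eq <;> fun_prop
    | ih x y =>
      rw [ContinuousLinearMap.completion_apply_coe, ContinuousLinearMap.completion_apply_coe,
        UniformSpace.Completion.inner_coe, UniformSpace.Completion.inner_coe]
      induction x, y using PreHilbertLimit.induction₂ with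
      | h n x y =>
        rw [← PreHilbertLimit.of_multiStep n (max m n) (le_max_right m n) x,
          ← PreHilbertLimit.of_multiStep n (max m n) (le_max_right m n) y,
          S.preCLM_of m _ (le_max_left m n), S.preCLM_of m _ (le_max_left m n)]
        refine (PreHilbertLimit.inner_of γ _ _ _).trans
          (Eq.trans ?_ (PreHilbertLimit.inner_of γ _ _ _).symm)
        rw [map_star, map_star, ContinuousLinearMap.star_eq_adjoint,
          ContinuousLinearMap.adjoint_inner_left]

theorem limitRep_of (m n : ℕ) (h : m ≤ n) (b : B m) (ψ : V n) :
    S.limitRep m b (HilbertLimit.of γ n ψ) =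
      HilbertLimit.of γ n (S.ρ n (multiPush S.φ m n h b) ψ) :=
  S.completion_of m n h b ψ

/-- The layer-`m` representations are compatible with operator pushing. -/
theorem limitRep_push (m : ℕ) (b : B m) : S.limitRep (m + 1) (S.φ m b) = S.limitRep m b := by
  refine HilbertLimit.clm_ext (m + 1) fun n hn ψ => ?_
  rw [S.limitRep_of (m + 1) n hn, S.limitRep_of m n (m.le_succ.trans hn)]
  have key : multiPush S.φ (m + 1) n hn (S.φ m b) =
      multiPush S.φ m n (m.le_succ.trans hn) b := by
    clear ψ
    induction n, hn using Nat.le_induction with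
    | base => rw [multiPush_self, multiPush_succ S.φ m m le_rfl, multiPush_self]
    | succ n hn ih =>
      rw [multiPush_succ S.φ (m + 1) n hn, ih, ← multiPush_succ S.φ m n (m.le_succ.trans hn)]
  rw [key]

end RepSystem

end LimitRep

/-! ## Tensor product operations -/

section Tensor

variable {𝕜 : Type v} [RCLike 𝕜] {E F G K : Type u} [NormedAddCommGroup E] [InnerProductSpace 𝕜 E]
  [NormedAddCommGroup F] [InnerProductSpace 𝕜 F] [NormedAddCommGroup G] [InnerProductSpace 𝕜 G]
  [NormedAddCommGroup K] [InnerProductSpace 𝕜 K]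

theorem inner_tensorTensorTensorComm (x y : (E ⊗[𝕜] F) ⊗[𝕜] (G ⊗[𝕜] K)) :
    inner 𝕜 (TensorProduct.tensorTensorTensorComm 𝕜 E F G K x)
      (TensorProduct.tensorTensorTensorComm 𝕜 E F G K y) = inner 𝕜 x y := by
  induction x with
  | zero => simp
  | add a b ha hb => simp only [map_add, inner_add_left, ha, hb]
  | tmul p q =>
    induction y with
    | zero => simp
    | add a b ha hb => simp only [map_add, inner_add_right, ha, hb]
    | tmul r s =>
      induction p with
      | zero => simp
      | add a b ha hb => simp only [TensorProduct.add_tmul, map_add, inner_add_left, ha, hb]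
      | tmul p₁ p₂ =>
        induction q with
        | zero => simp
        | add a b ha hb => simp only [TensorProduct.tmul_add, map_add, inner_add_left, ha, hb]
        | tmul q₁ q₂ =>
          induction r with
          | zero => simp
          | add a b ha hb => simp only [TensorProduct.add_tmul, map_add, inner_add_right, ha, hb]
          | tmul r₁ r₂ =>
            induction s with
            | zero => simp
            | add a b ha hb =>
              simp only [TensorProduct.tmul_add, map_add, inner_add_right, ha, hb]
            | tmul s₁ s₂ =>
              simp only [TensorProduct.tensorTensorTensorComm_tmul, TensorProduct.inner_tmul]
              ring

variable (𝕜 E F G K) in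
/-- The exchange `(E ⊗ F) ⊗ (G ⊗ K) ≅ (E ⊗ G) ⊗ (F ⊗ K)` of the two middle factors. -/
def tensorExchange : (E ⊗[𝕜] F) ⊗[𝕜] (G ⊗[𝕜] K) ≃ₗᵢ[𝕜] (E ⊗[𝕜] G) ⊗[𝕜] (F ⊗[𝕜] K) :=
  (TensorProduct.tensorTensorTensorComm 𝕜 E F G K).isometryOfInner inner_tensorTensorTensorComm

end Tensor

/-! ## Finite-dimensional Hilbert spaces and their tensor products -/

/-- A finite-dimensional complex Hilbert space. -/
structure FinHilb : Type (u + 1) where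
  carrier : Type u
  [normed : NormedAddCommGroup carrier]
  [innerProduct : InnerProductSpace ℂ carrier]
  [finDim : FiniteDimensional ℂ carrier]

instance : CoeSort FinHilb.{u} (Type u) := ⟨FinHilb.carrier⟩

attribute [instance] FinHilb.normed FinHilb.innerProduct FinHilb.finDim

/-- The tensor product of two finite-dimensional Hilbert spaces. -/
def FinHilb.tensor (E F : FinHilb.{u}) : FinHilb.{u} := ⟨E ⊗[ℂ] F⟩

infixr:70 "⊠" => FinHilb.tensor

namespace FinHilb

variable {E F G K : FinHilb.{u}}

/-- The product vector `x ⊗ y`. -/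
def tmul (x : E) (y : F) : (E ⊠ F : FinHilb.{u}) := x ⊗ₜ[ℂ] y

theorem tmul_zero (x : E) : tmul x (0 : F) = 0 := TensorProduct.tmul_zero _ x

theorem zero_tmul (y : F) : tmul (0 : E) y = 0 := TensorProduct.zero_tmul _ y

theorem tmul_add (x : E) (y z : F) : tmul x (y + z) = tmul x y + tmul x z :=
  TensorProduct.tmul_add x y z

theorem add_tmul (x y : E) (z : F) : tmul (x + y) z = tmul x z + tmul y z :=
  TensorProduct.add_tmul x y z

theorem tensor_induction {C : (E ⊠ F : FinHilb.{u}) → Prop} (z : (E ⊠ F : FinHilb.{u}))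
    (zero : C 0) (tmul : ∀ x y, C (tmul x y)) (add : ∀ x y, C x → C y → C (x + y)) : C z :=
  TensorProduct.induction_on z zero tmul add

/-- The isometry `ψ ↦ ψ ⊗ θ` for a unit vector `θ`. -/
def tensorRight (θ : F) (hθ : ‖θ‖ = 1) : E →ₗᵢ[ℂ] (E ⊠ F : FinHilb.{u}) where
  toLinearMap := (TensorProduct.mk ℂ E F).flip θ
  norm_map' ψ := (TensorProduct.norm_tmul ψ θ).trans (by rw [hθ, mul_one])

/-- The isometry `ψ ↦ θ ⊗ ψ` for a unit vector `θ`. -/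
def tensorLeft (θ : E) (hθ : ‖θ‖ = 1) : F →ₗᵢ[ℂ] (E ⊠ F : FinHilb.{u}) where
  toLinearMap := TensorProduct.mk ℂ E F θ
  norm_map' ψ := (TensorProduct.norm_tmul θ ψ).trans (by rw [hθ, one_mul])

/-- The tensor product `f ⊗ g` of two isometries. -/
def mapIsometry (f : E →ₗᵢ[ℂ] G) (g : F →ₗᵢ[ℂ] K) :
    (E ⊠ F : FinHilb.{u}) →ₗᵢ[ℂ] (G ⊠ K : FinHilb.{u}) :=
  TensorProduct.mapIsometry f g

/-- The tensor product `f ⊗ g` of two unitaries. -/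
def congrIsometry (f : E ≃ₗᵢ[ℂ] G) (g : F ≃ₗᵢ[ℂ] K) :
    (E ⊠ F : FinHilb.{u}) ≃ₗᵢ[ℂ] (G ⊠ K : FinHilb.{u}) :=
  TensorProduct.congrIsometry f g

theorem congrIsometry_tmul (f : E ≃ₗᵢ[ℂ] G) (g : F ≃ₗᵢ[ℂ] K) (x : E) (y : F) :
    congrIsometry f g (tmul x y) = tmul (f x) (g y) := rfl

/-- The exchange `(E ⊗ F) ⊗ (G ⊗ K) ≅ (E ⊗ G) ⊗ (F ⊗ K)` of the two middle factors. -/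
def exchange (E F G K : FinHilb.{u}) :
    ((E ⊠ F) ⊠ (G ⊠ K) : FinHilb.{u}) ≃ₗᵢ[ℂ] ((E ⊠ G) ⊠ (F ⊠ K) : FinHilb.{u}) :=
  tensorExchange ℂ E F G K

theorem exchange_tmul (a : E) (b : F) (c : G) (d : K) :
    exchange E F G K (tmul (tmul a b) (tmul c d)) = tmul (tmul a c) (tmul b d) := rfl

/-- The `*`-homomorphism `O ↦ O ⊗ 1` from `B(E)` to `B(E ⊗ F)`. -/
def ampRight (E F : FinHilb.{u}) :
    (E →L[ℂ] E) →⋆ₐ[ℂ] ((E ⊠ F : FinHilb.{u}) →L[ℂ] (E ⊠ F : FinHilb.{u})) where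
  toFun O := O.rTensor F
  map_one' := ContinuousLinearMap.rTensor_one _
  map_mul' O P := ContinuousLinearMap.rTensor_mul _ O P
  map_zero' := ContinuousLinearMap.rTensor_zero _
  map_add' O P := ContinuousLinearMap.rTensor_add _ O P
  commutes' r := by
    rw [Algebra.algebraMap_eq_smul_one, Algebra.algebraMap_eq_smul_one]
    exact (ContinuousLinearMap.rTensor_smul _ r 1).trans
      (congrArg (r • ·) (ContinuousLinearMap.rTensor_one _))
  map_star' O := (ContinuousLinearMap.adjoint_rTensor F O).symm

theorem ampRight_tmul (O : E →L[ℂ] E) (x : E) (y : F) :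
    ampRight E F O (tmul x y) = tmul (O x) y := rfl

/-- The `*`-homomorphism `O ↦ 1 ⊗ O` from `B(F)` to `B(E ⊗ F)`. -/
def ampLeft (E F : FinHilb.{u}) :
    (F →L[ℂ] F) →⋆ₐ[ℂ] ((E ⊠ F : FinHilb.{u}) →L[ℂ] (E ⊠ F : FinHilb.{u})) where
  toFun O := O.lTensor E
  map_one' := ContinuousLinearMap.lTensor_one _
  map_mul' O P := ContinuousLinearMap.lTensor_mul _ O P
  map_zero' := ContinuousLinearMap.lTensor_zero _
  map_add' O P := ContinuousLinearMap.lTensor_add _ O P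
  commutes' r := by
    rw [Algebra.algebraMap_eq_smul_one, Algebra.algebraMap_eq_smul_one]
    exact (ContinuousLinearMap.lTensor_smul _ r 1).trans
      (congrArg (r • ·) (ContinuousLinearMap.lTensor_one _))
  map_star' O := (ContinuousLinearMap.adjoint_lTensor E O).symm

/-- The `*`-isomorphism `O ↦ U O U†` implemented by a unitary `U : E → F`. -/
def conj (U : E ≃ₗᵢ[ℂ] F) : (E →L[ℂ] E) →⋆ₐ[ℂ] (F →L[ℂ] F) :=
  U.conjStarAlgEquiv.toStarAlgHom

theorem conj_apply (U : E ≃ₗᵢ[ℂ] F) (O : E →L[ℂ] E) (x : E) : conj U O (U x) = U (O x) := by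
  change U (O (U.symm (U x))) = _
  rw [U.symm_apply_apply]

/-- A vector `χ ∈ E ⊗ F` is maximally entangled if `χ = d^{-1/2} ∑ₖ |k⟩ ⊗ |k⟩` for orthonormal
bases of `E` and `F` of the same size `d ≥ 1`. -/
def IsMaximallyEntangled (χ : (E ⊠ F : FinHilb.{u})) : Prop :=
  ∃ d : ℕ, 0 < d ∧ ∃ (e : OrthonormalBasis (Fin d) ℂ E) (f : OrthonormalBasis (Fin d) ℂ F),
    χ = ((√(d : ℝ) : ℝ) : ℂ)⁻¹ • ∑ k, tmul (e k) (f k)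

theorem IsMaximallyEntangled.norm_eq_one {χ : (E ⊠ F : FinHilb.{u})}
    (h : IsMaximallyEntangled χ) : ‖χ‖ = 1 := by
  obtain ⟨d, hd, e, f, rfl⟩ := h
  have hd' : (0 : ℝ) < d := by exact_mod_cast hd
  have h0 : ∀ i j, inner ℂ (tmul (e i) (f i)) (tmul (e j) (f j)) =
      inner ℂ (e i) (e j) * inner ℂ (f i) (f j) :=
    fun i j => TensorProduct.inner_tmul ℂ (e i) (e j) (f i) (f j)
  have h1 : inner ℂ (∑ k, tmul (e k) (f k)) (∑ k, tmul (e k) (f k)) = (d : ℂ) := by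
    rw [sum_inner]
    simp only [inner_sum, h0, e.inner_eq_ite, f.inner_eq_ite]
    simp
  have h2 : ‖∑ k, tmul (e k) (f k)‖ = √(d : ℝ) := by
    rw [@norm_eq_sqrt_re_inner ℂ, h1]
    simp
  rw [norm_smul, h2, norm_inv, Complex.norm_real, Real.norm_of_nonneg (Real.sqrt_nonneg _)]
  exact inv_mul_cancel₀ (Real.sqrt_pos.2 hd').ne'

end FinHilb

open FinHilb

/-! ## Layered holographic networks -/

/-- The part of a layered network on one side (`A` or its complement) of the RT surface.
`bdy Λ` is the boundary Hilbert space of that side at layer `Λ`. Layer `Λ` brings in bulk (logical)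
legs `bulk Λ`, auxiliary legs `anc Λ` (the opened internal bonds of that side) and one half `rt Λ`
of the pairs sitting on the new bonds of the RT surface. -/
structure Wedge : Type (u + 1) where
  bdy : ℕ → FinHilb.{u}
  bulk : ℕ → FinHilb.{u}
  anc : ℕ → FinHilb.{u}
  rt : ℕ → FinHilb.{u}
  /-- The opened-up innermost network, a unitary `H_a ⊗ H_χ ⊗ H_γ → H_A`. -/
  U₀ : (bulk 0 ⊠ anc 0 ⊠ rt 0 : FinHilb.{u}) ≃ₗᵢ[ℂ] bdy 0
  /-- The opened-up layer `Λ + 1`, a unitary `H_A^Λ ⊗ (H_δa ⊗ H_χδa ⊗ H_δγ) → H_A^{Λ+1}`. -/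
  U : ∀ Λ, (bdy Λ ⊠ bulk (Λ + 1) ⊠ anc (Λ + 1) ⊠ rt (Λ + 1) : FinHilb.{u}) ≃ₗᵢ[ℂ] bdy (Λ + 1)
  /-- The reference state of the bulk legs. -/
  bulkState : ∀ Λ, bulk Λ
  norm_bulkState : ∀ Λ, ‖bulkState Λ‖ = 1
  /-- The state of the auxiliary legs. -/
  ancState : ∀ Λ, anc Λ
  norm_ancState : ∀ Λ, ‖ancState Λ‖ = 1

namespace Wedge

variable (W : Wedge.{u})

/-- The degrees of freedom added to one side by layer `Λ`. -/
abbrev New (Λ : ℕ) : FinHilb.{u} := W.bulk Λ ⊠ W.anc Λ ⊠ W.rt Λ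

/-- The isometry `r ↦ |i⟩ ⊗ |χ⟩ ⊗ r` fixing the bulk and auxiliary legs to their states. -/
def fill (Λ : ℕ) : W.rt Λ →ₗᵢ[ℂ] W.New Λ :=
  (tensorLeft (W.bulkState Λ) (W.norm_bulkState Λ)).comp
    (tensorLeft (W.ancState Λ) (W.norm_ancState Λ))

/-- The layer-to-layer operator pushing map `O ↦ U (O ⊗ 1) U†` on `B(H_A^Λ)`. -/
def push (Λ : ℕ) : (W.bdy Λ →L[ℂ] W.bdy Λ) →⋆ₐ[ℂ] (W.bdy (Λ + 1) →L[ℂ] W.bdy (Λ + 1)) :=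
  (conj (W.U Λ)).comp (ampRight (W.bdy Λ) (W.New (Λ + 1)))

theorem push_apply (Λ : ℕ) (O : W.bdy Λ →L[ℂ] W.bdy Λ)
    (x : (W.bdy Λ ⊠ W.New (Λ + 1) : FinHilb.{u})) :
    W.push Λ O (W.U Λ x) = W.U Λ (ampRight (W.bdy Λ) (W.New (Λ + 1)) O x) :=
  conj_apply (W.U Λ) _ x

/-- The operators `1 ⊗ 1 ⊗ R` on the degrees of freedom added by layer `Λ`, `R` acting on the
RT legs. -/
def rtNew (Λ : ℕ) : (W.rt Λ →L[ℂ] W.rt Λ) →⋆ₐ[ℂ] (W.New Λ →L[ℂ] W.New Λ) :=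
  (ampLeft (W.bulk Λ) (W.anc Λ ⊠ W.rt Λ)).comp (ampLeft (W.anc Λ) (W.rt Λ))

/-- The RT algebra at layer `Λ`, a `*`-subalgebra of `B(H_A^Λ)`: it is generated by the operators
on the RT legs brought in by the layers `0, …, Λ`, pushed to layer `Λ`. -/
def rtAlgebra : ∀ Λ, StarSubalgebra ℂ (W.bdy Λ →L[ℂ] W.bdy Λ)
  | 0 => ((conj W.U₀).comp (W.rtNew 0)).range
  | Λ + 1 => (rtAlgebra Λ).map (W.push Λ) ⊔
      ((conj (W.U Λ)).comp
        ((ampLeft (W.bdy Λ) (W.New (Λ + 1))).comp (W.rtNew (Λ + 1)))).range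

end Wedge

/-- A layered network bipartitioned into a region `A` and its complement `Ac` so that every layer
factorizes into unitaries on the two sides, glued along the RT surface by maximally entangled
states `rtState Λ`. -/
structure HolographicNetwork : Type (u + 1) where
  A : Wedge.{u}
  Ac : Wedge.{u}
  rtState : ∀ Λ, (A.rt Λ ⊠ Ac.rt Λ : FinHilb.{u})
  rtState_maxEntangled : ∀ Λ, IsMaximallyEntangled (rtState Λ)

namespace HolographicNetwork

variable (N : HolographicNetwork.{u})

/-- The boundary Hilbert space `H^Λ = H_A^Λ ⊗ H_{Ac}^Λ`. -/
abbrev Bdy (Λ : ℕ) : FinHilb.{u} := N.A.bdy Λ ⊠ N.Ac.bdy Λ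

/-- The state of all the degrees of freedom added by layer `Λ`:
`|i⟩ |χ_a⟩ |χ_γ⟩ |j⟩ |χ_{ac}⟩`. -/
def newState (Λ : ℕ) : (N.A.New Λ ⊠ N.Ac.New Λ : FinHilb.{u}) :=
  mapIsometry (N.A.fill Λ) (N.Ac.fill Λ) (N.rtState Λ)

theorem norm_newState (Λ : ℕ) : ‖N.newState Λ‖ = 1 :=
  ((mapIsometry (N.A.fill Λ) (N.Ac.fill Λ)).norm_map _).trans
    (N.rtState_maxEntangled Λ).norm_eq_one

/-- The layer-to-layer isometry
`γ ψ = U_A U_{Ac} (ψ ⊗ |i⟩ |χ_a⟩ |χ_γ⟩ |j⟩ |χ_{ac}⟩)`. -/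
def step (Λ : ℕ) : N.Bdy Λ →ₗᵢ[ℂ] N.Bdy (Λ + 1) :=
  (((exchange (N.A.bdy Λ) (N.Ac.bdy Λ) (N.A.New (Λ + 1)) (N.Ac.New (Λ + 1))).trans
    (congrIsometry (N.A.U Λ) (N.Ac.U Λ))).toLinearIsometry).comp
    (tensorRight (N.newState (Λ + 1)) (N.norm_newState (Λ + 1)))

theorem step_apply (Λ : ℕ) (ψ : N.Bdy Λ) :
    N.step Λ ψ = congrIsometry (N.A.U Λ) (N.Ac.U Λ)
      (exchange (N.A.bdy Λ) (N.Ac.bdy Λ) (N.A.New (Λ + 1)) (N.Ac.New (Λ + 1))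
        (tmul ψ (N.newState (Λ + 1)))) := rfl

/-- The network state `Ψ^Λ`. -/
def state : ∀ Λ, N.Bdy Λ
  | 0 => congrIsometry N.A.U₀ N.Ac.U₀ (N.newState 0)
  | Λ + 1 => N.step Λ (state Λ)

theorem push_step (Λ : ℕ) (O : N.A.bdy Λ →L[ℂ] N.A.bdy Λ) (ψ : N.Bdy Λ) :
    ampRight (N.A.bdy (Λ + 1)) (N.Ac.bdy (Λ + 1)) (N.A.push Λ O) (N.step Λ ψ) =
      N.step Λ (ampRight (N.A.bdy Λ) (N.Ac.bdy Λ) O ψ) := by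
  rw [N.step_apply, N.step_apply]
  induction N.newState (Λ + 1) using tensor_induction with
  | zero => simp only [tmul_zero, map_zero]
  | add x y hx hy => simp only [tmul_add, map_add, hx, hy]
  | tmul c d =>
    induction ψ using tensor_induction with
    | zero => simp only [zero_tmul, map_zero]
    | add x y hx hy => simp only [add_tmul, map_add, hx, hy]
    | tmul a b =>
      rw [exchange_tmul, congrIsometry_tmul, ampRight_tmul, ampRight_tmul, exchange_tmul,
        congrIsometry_tmul, Wedge.push_apply, ampRight_tmul]

/-- The inductive system of the algebras `B(H_A^Λ)`, acting on `H^Λ` as `O ⊗ 1`, with operator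
pushing on the `A` side. -/
def repSystem : RepSystem N.step (fun Λ => N.A.bdy Λ →L[ℂ] N.A.bdy Λ) where
  φ := N.A.push
  ρ Λ := ampRight (N.A.bdy Λ) (N.Ac.bdy Λ)
  compat := N.push_step

/-- The inductive limit Hilbert space of the network. -/
abbrev LimitSpace : Type u := HilbertLimit N.step

/-- The limit `[Ψ^Λ]` of the network states. -/
def limitState : N.LimitSpace := HilbertLimit.of N.step 0 (N.state 0)

theorem limitState_eq (Λ : ℕ) : N.limitState = HilbertLimit.of N.step Λ (N.state Λ) := by
  induction Λ with
  | zero => rfl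
  | succ Λ ih => rw [ih]; exact (HilbertLimit.of_step N.step Λ (N.state Λ)).symm

/-- The inductive limit C*-algebra of the RT algebras, in its representation on the limit Hilbert
space: the norm closure of the increasing union of the `*`-subalgebras `π([O])`, `O` in the RT
algebra of layer `Λ`. -/
def rtCStarAlgebra : StarSubalgebra ℂ (N.LimitSpace →L[ℂ] N.LimitSpace) :=
  (⨆ Λ, (N.A.rtAlgebra Λ).map (N.repSystem.limitRep Λ)).topologicalClosure

end HolographicNetwork

/-! ## Von Neumann algebras -/

section VonNeumann

variable {H : Type u} [NormedAddCommGroup H] [InnerProductSpace ℂ H] [CompleteSpace H]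

/-- The von Neumann algebra `S''` generated by a unital `*`-algebra `S` of bounded operators. -/
def bicommutant (S : StarSubalgebra ℂ (H →L[ℂ] H)) : VonNeumannAlgebra H where
  toStarSubalgebra := StarSubalgebra.centralizer ℂ
    (StarSubalgebra.centralizer ℂ (S : Set (H →L[ℂ] H)) : Set (H →L[ℂ] H))
  centralizer_centralizer' := by
    change Set.centralizer (Set.centralizer (Set.centralizer _)) = Set.centralizer _
    rw [Set.centralizer_centralizer_centralizer]

theorem coe_bicommutant (S : StarSubalgebra ℂ (H →L[ℂ] H)) :
    (bicommutant S : Set (H →L[ℂ] H)) =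
      Set.centralizer (Set.centralizer (S : Set (H →L[ℂ] H))) := by
  have := StarSubalgebra.coe_centralizer_centralizer ℂ (S : Set (H →L[ℂ] H))
  rwa [StarMemClass.star_coe_eq, Set.union_self] at this

/-- A factor: a nonzero von Neumann algebra with `M ∩ M' = ℂ 1`. -/
def IsFactor (M : VonNeumannAlgebra H) : Prop :=
  Nontrivial H ∧ ∀ x ∈ M, x ∈ M.commutant → ∃ c : ℂ, x = c • (1 : H →L[ℂ] H)

/-- The identity of `M` is a finite projection: every isometry in `M` is unitary. -/
def IsFiniteVN (M : VonNeumannAlgebra H) : Prop :=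
  ∀ v ∈ M, star v * v = 1 → v * star v = 1

/-- `e` is an abelian projection of `M`: `e ∈ M` is a projection and `e M e` is commutative. -/
def IsAbelianProjection (M : VonNeumannAlgebra H) (e : H →L[ℂ] H) : Prop :=
  e ∈ M ∧ IsStarProjection e ∧ ∀ x ∈ M, ∀ y ∈ M, Commute (e * x * e) (e * y * e)

/-- Type II₁: a nonzero finite von Neumann algebra without nonzero abelian projections. -/
def IsTypeIIOne (M : VonNeumannAlgebra H) : Prop :=
  Nontrivial H ∧ IsFiniteVN M ∧ ∀ e, IsAbelianProjection M e → e = 0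

/-- The functional `x ↦ ⟨Ψ, x Ψ⟩` on a `*`-algebra of operators. -/
def vectorFunctional (Ψ : H) (S : StarSubalgebra ℂ (H →L[ℂ] H)) : S →ₗ[ℂ] ℂ where
  toFun x := inner ℂ Ψ ((x : H →L[ℂ] H) Ψ)
  map_add' x y := by simp
  map_smul' c x := by simp

open scoped ComplexOrder in
/-- A tracial state: a positive unital functional with `τ (x y) = τ (y x)`. -/
structure IsTracialState {S : StarSubalgebra ℂ (H →L[ℂ] H)} (τ : S →ₗ[ℂ] ℂ) : Prop where
  nonneg : ∀ x, 0 ≤ τ (star x * x)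
  one : τ 1 = 1
  tracial : ∀ x y, τ (x * y) = τ (y * x)

/-- A functional on an algebra of operators is normal (ultraweakly continuous) if it has the form
`x ↦ ∑ₙ ⟨ξₙ, x ηₙ⟩` with `∑ ‖ξₙ‖² < ∞` and `∑ ‖ηₙ‖² < ∞`. -/
def IsNormalFunctional {S : StarSubalgebra ℂ (H →L[ℂ] H)} (τ : S →ₗ[ℂ] ℂ) : Prop :=
  ∃ ξ η : ℕ → H, (Summable fun n => ‖ξ n‖ ^ 2) ∧ (Summable fun n => ‖η n‖ ^ 2) ∧
    ∀ x : S, HasSum (fun n => inner ℂ (ξ n) ((x : H →L[ℂ] H) (η n))) (τ x)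

end VonNeumann

/-- The inductive-limit RT von Neumann algebra of the region `A`, `π(𝒜̂)''`. -/
def HolographicNetwork.rtVonNeumann (N : HolographicNetwork.{u}) :
    VonNeumannAlgebra N.LimitSpace :=
  bicommutant N.rtCStarAlgebra

end

/-! ### Reflecting vectors: trace and finiteness -/

section TracialVector

variable {H : Type u} [NormedAddCommGroup H] [InnerProductSpace ℂ H] [CompleteSpace H]

/-! Let `P` be the `*`-algebra generated by the RT-leg operators of side `A` on the limit space; the
algebra to be studied is `P''`. Two facts about `Ψ` carry everything, and `IsReflectingVector`
records them. Across a maximally entangled pair, an operator on one half acts as its transpose on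
the other half. Hence each leg operator `x` has a partner `y` in `P'`, supported on the complement,
with `x Ψ = y Ψ` and `x* Ψ = y* Ψ`, and this property passes to all of `P`. Moreover `P' Ψ` is
dense, because `P'` contains every operator of the complement and every operator on the bulk and
auxiliary legs of `A`, and these suffice to turn the reference state of a layer into any vector
(`newState_cyclic`, `of_mem`).

Density makes `Ψ` separating for `P''`; reflection gives `⟨Ψ, x p Ψ⟩ = ⟨Ψ, p x Ψ⟩` for `p ∈ P`, and
approximation on `Ψ` extends this to `P''` (`tracial`). A faithful trace forces finiteness.

Factor: for central `z` the functional `y ↦ ⟨Ψ, z y Ψ⟩` is again tracial. A full matrix algebra has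
only one trace up to scale, so removing one leg after another yields `⟨Ψ, z p Ψ⟩ = ⟨Ψ, p Ψ⟩ ⟨Ψ, z
Ψ⟩` on `P` (`weightedFunctional_legsBelow`), which makes `z` scalar.

No abelian projection: approximate `e Ψ` by `x Ψ` with `x` built from finitely many legs, and choose
in a later leg of dimension at least two self-adjoint unitaries `u`, `v` with `τ(u v u v) ≤ 0`. They
commute with `x`, hence almost with `e`, so commutativity of `e P'' e` makes `[u, v] e Ψ` small. But
the trace factorizes over distinct legs, so `‖[u, v] x Ψ‖² ≥ 2 ‖x Ψ‖²`. Thus `e Ψ` is arbitrarily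
small, and `e = 0`. -/

theorem mem_centralizer_coe {S : StarSubalgebra ℂ (H →L[ℂ] H)} {x : H →L[ℂ] H} :
    x ∈ StarSubalgebra.centralizer ℂ (S : Set (H →L[ℂ] H)) ↔ ∀ y ∈ S, y * x = x * y := by
  rw [StarSubalgebra.mem_centralizer_iff]
  exact ⟨fun h y hy => (h y hy).1, fun h y hy => ⟨h y hy, h _ (star_mem hy)⟩⟩

theorem mem_bicommutant {S : StarSubalgebra ℂ (H →L[ℂ] H)} {x : H →L[ℂ] H} :
    x ∈ bicommutant S ↔
      ∀ y ∈ StarSubalgebra.centralizer ℂ (S : Set (H →L[ℂ] H)), y * x = x * y :=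
  mem_centralizer_coe

theorem le_bicommutant (S : StarSubalgebra ℂ (H →L[ℂ] H)) :
    S ≤ (bicommutant S).toStarSubalgebra := fun x hx =>
  mem_bicommutant.2 fun _ hy => (mem_centralizer_coe.1 hy x hx).symm

theorem isClosed_bicommutant (S : StarSubalgebra ℂ (H →L[ℂ] H)) :
    IsClosed ((bicommutant S).toStarSubalgebra : Set (H →L[ℂ] H)) := by
  have h : ((bicommutant S).toStarSubalgebra : Set (H →L[ℂ] H)) =
      ⋂ y ∈ StarSubalgebra.centralizer ℂ (S : Set (H →L[ℂ] H)), {x | y * x = x * y} := by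
    ext x
    simpa using mem_bicommutant
  rw [h]
  exact isClosed_biInter fun y _ =>
    isClosed_eq (continuous_const.mul continuous_id) (continuous_id.mul continuous_const)

theorem topologicalClosure_le_bicommutant (S : StarSubalgebra ℂ (H →L[ℂ] H)) :
    S.topologicalClosure ≤ (bicommutant S).toStarSubalgebra :=
  StarSubalgebra.topologicalClosure_minimal (le_bicommutant S) (isClosed_bicommutant S)

/-- Since `S''` is norm closed, it contains the closure of `S`; whatever commutes with `S` therefore
commutes with the closure. This reduces the von Neumann algebra of the C*-algebra to that of its
generators. -/
theorem bicommutant_topologicalClosure (S : StarSubalgebra ℂ (H →L[ℂ] H)) :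
    bicommutant S.topologicalClosure = bicommutant S := by
  have h : StarSubalgebra.centralizer ℂ (S.topologicalClosure : Set (H →L[ℂ] H)) =
      StarSubalgebra.centralizer ℂ (S : Set (H →L[ℂ] H)) := by
    refine le_antisymm (StarSubalgebra.centralizer_le ℂ (S : Set (H →L[ℂ] H))
      (S.topologicalClosure : Set (H →L[ℂ] H)) S.le_topologicalClosure) fun y hy => ?_
    exact mem_centralizer_coe.2 fun x hx =>
      (mem_bicommutant.1 (topologicalClosure_le_bicommutant S hx) y hy).symm
  ext x
  rw [mem_bicommutant, mem_bicommutant, h]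

/-- The elements of `P` that have a reflection in the commutant of `P` relative to `Ψ`. -/
noncomputable def reflectible (P : StarSubalgebra ℂ (H →L[ℂ] H)) (Ψ : H) : StarSubalgebra ℂ (H →L[ℂ] H) where
  carrier := {x | x ∈ P ∧ ∃ y ∈ StarSubalgebra.centralizer ℂ (P : Set (H →L[ℂ] H)),
    x Ψ = y Ψ ∧ star x Ψ = star y Ψ}
  mul_mem' := by
    rintro a b ⟨ha, y, hy, h1, h2⟩ ⟨hb, z, hz, h3, h4⟩
    -- Reflection reverses products: `a b Ψ = a z Ψ = z a Ψ = z y Ψ`.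
    refine ⟨mul_mem ha hb, z * y, mul_mem hz hy, ?_, ?_⟩
    · have h5 := congrArg (fun T => T Ψ) (mem_centralizer_coe.1 hz a ha)
      change a (z Ψ) = z (a Ψ) at h5
      change a (b Ψ) = z (y Ψ)
      rw [h3, h5, h1]
    · have h5 := congrArg (fun T => T Ψ)
        (mem_centralizer_coe.1 (star_mem hy) (star b) (star_mem hb))
      change star b (star y Ψ) = star y (star b Ψ) at h5
      rw [star_mul, star_mul]
      change star b (star a Ψ) = star y (star z Ψ)
      rw [h2, h5, h4]
  add_mem' := by
    rintro a b ⟨ha, y, hy, h1, h2⟩ ⟨hb, z, hz, h3, h4⟩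
    refine ⟨add_mem ha hb, y + z, add_mem hy hz, ?_, ?_⟩
    · rw [add_apply, add_apply, h1, h3]
    · rw [star_add, star_add, add_apply, add_apply, h2, h4]
  algebraMap_mem' c :=
    ⟨P.algebraMap_mem c, _, StarSubalgebra.algebraMap_mem _ c, rfl, rfl⟩
  star_mem' := by
    rintro a ⟨ha, y, hy, h1, h2⟩
    exact ⟨star_mem ha, star y, star_mem hy, h2, by rw [star_star, star_star, h1]⟩

/-- A unit vector `Ψ` that is cyclic for the commutant of `P` and such that every `x ∈ P` has a
reflection `x'` in the commutant. -/
structure IsReflectingVector (P : StarSubalgebra ℂ (H →L[ℂ] H)) (Ψ : H) : Prop where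
  norm_eq_one : ‖Ψ‖ = 1
  cyclic : Dense {ξ | ∃ y ∈ StarSubalgebra.centralizer ℂ (P : Set (H →L[ℂ] H)), y Ψ = ξ}
  reflect : ∀ x ∈ P, ∃ y ∈ StarSubalgebra.centralizer ℂ (P : Set (H →L[ℂ] H)),
    x Ψ = y Ψ ∧ star x Ψ = star y Ψ

theorem inner_apply_eq_star (x : H →L[ℂ] H) (ξ η : H) :
    inner ℂ ξ (x η) = inner ℂ (star x ξ) η := by
  rw [ContinuousLinearMap.star_eq_adjoint, ContinuousLinearMap.adjoint_inner_left]

theorem inner_star_apply (x : H →L[ℂ] H) (ξ η : H) :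
    inner ℂ ξ (star x η) = inner ℂ (x ξ) η := by
  rw [inner_apply_eq_star, star_star]

/-- The easy half of the density theorem, at a single vector. The closure of `P Ψ` and its
orthogonal complement are both `P`-invariant, so the projection onto that closure lies in `P'` and
commutes with `x`; as it fixes `Ψ`, it also fixes `x Ψ`. -/
theorem apply_mem_closure {P : StarSubalgebra ℂ (H →L[ℂ] H)} {x : H →L[ℂ] H}
    (hx : x ∈ bicommutant P) (Ψ : H) : x Ψ ∈ closure {ξ | ∃ p ∈ P, p Ψ = ξ} := by
  let ev : (H →L[ℂ] H) →ₗ[ℂ] H := (ContinuousLinearMap.apply ℂ H Ψ).toLinearMap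
  let L : Submodule ℂ H := P.toSubalgebra.toSubmodule.map ev
  have hL : (L : Set H) = {ξ | ∃ p ∈ P, p Ψ = ξ} := rfl
  let K := L.topologicalClosure
  have hK : ∀ p ∈ P, ∀ ξ ∈ K, p ξ ∈ K := by
    intro p hp ξ hξ
    refine map_mem_closure p.continuous hξ ?_
    rintro _ ⟨q, hq, rfl⟩
    exact ⟨p * q, mul_mem (S := StarSubalgebra ℂ (H →L[ℂ] H)) hp hq, rfl⟩
  have : CompleteSpace K := L.isClosed_topologicalClosure.completeSpace_coe
  have hperp : ∀ p ∈ P, ∀ ξ ∈ Kᗮ, p ξ ∈ Kᗮ := by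
    intro p hp ξ hξ
    rw [Submodule.mem_orthogonal] at hξ ⊢
    intro η hη
    rw [inner_apply_eq_star]
    exact hξ _ (hK _ (star_mem hp) η hη)
  have hcomm : K.starProjection ∈ StarSubalgebra.centralizer ℂ (P : Set (H →L[ℂ] H)) := by
    refine mem_centralizer_coe.2 fun p hp => ?_
    ext ξ
    change p (K.starProjection ξ) = K.starProjection (p ξ)
    refine (Submodule.eq_starProjection_of_mem_of_inner_eq_zero (hK p hp _ ?_) ?_).symm
    · exact Submodule.starProjection_apply_mem _ _
    · intro η hη
      rw [← map_sub]
      have h1 : ξ - K.starProjection ξ ∈ Kᗮ := Submodule.sub_starProjection_mem_orthogonal _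
      have h2 := hperp p hp _ h1
      rw [Submodule.mem_orthogonal'] at h2
      exact h2 η hη
  have hΨ : Ψ ∈ K := L.le_topologicalClosure ⟨1, one_mem P, rfl⟩
  have h := congrArg (fun T => T Ψ) (mem_bicommutant.1 hx _ hcomm)
  change K.starProjection (x Ψ) = x (K.starProjection Ψ) at h
  rw [Submodule.starProjection_eq_self_iff.2 hΨ] at h
  rw [← hL]
  have hmem : K.starProjection (x Ψ) ∈ K := Submodule.starProjection_apply_mem _ _
  rw [h] at hmem
  exact hmem

namespace IsReflectingVector

variable {P : StarSubalgebra ℂ (H →L[ℂ] H)} {Ψ : H}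

theorem ne_zero (h : IsReflectingVector P Ψ) : Ψ ≠ 0 := by
  rintro rfl
  simpa using h.norm_eq_one

theorem inner_self (h : IsReflectingVector P Ψ) : inner ℂ Ψ Ψ = (1 : ℂ) := by
  rw [inner_self_eq_norm_sq_to_K, h.norm_eq_one]
  simp

/-- The vector is separating for the bicommutant. -/
theorem separating (h : IsReflectingVector P Ψ) {x : H →L[ℂ] H} (hx : x ∈ bicommutant P)
    (h0 : x Ψ = 0) : x = 0 := by
  refine ContinuousLinearMap.ext fun ξ => ?_
  refine congrFun (Continuous.ext_on h.cyclic x.continuous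
    (0 : H →L[ℂ] H).continuous ?_) ξ
  rintro _ ⟨y, hy, rfl⟩
  have := congrArg (fun T => T Ψ) (mem_bicommutant.1 hx y hy)
  change y (x Ψ) = x (y Ψ) at this
  rw [← this, h0, map_zero]
  rfl

/-- Replace `p` by its reflection `y`, move `y` past `x`, then turn `y* Ψ` back into `p* Ψ`. Both
equalities of the reflection are used. -/
theorem inner_mul_comm (h : IsReflectingVector P Ψ) {x p : H →L[ℂ] H} (hx : x ∈ bicommutant P)
    (hp : p ∈ P) : inner ℂ Ψ (x (p Ψ)) = inner ℂ Ψ (p (x Ψ)) := by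
  obtain ⟨y, hy, h1, h2⟩ := h.reflect p hp
  have h3 := congrArg (fun T => T Ψ) (mem_bicommutant.1 hx y hy)
  change y (x Ψ) = x (y Ψ) at h3
  rw [h1, ← h3, inner_apply_eq_star, ← h2, ← inner_apply_eq_star]

theorem norm_star_apply (h : IsReflectingVector P Ψ) {p : H →L[ℂ] H} (hp : p ∈ P) :
    ‖star p Ψ‖ = ‖p Ψ‖ := by
  have h1 := h.inner_mul_comm (le_bicommutant P hp) (star_mem hp)
  rw [inner_apply_eq_star p, inner_star_apply p Ψ (p Ψ), inner_self_eq_norm_sq_to_K,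
    inner_self_eq_norm_sq_to_K] at h1
  have h2 : ‖star p Ψ‖ ^ 2 = ‖p Ψ‖ ^ 2 := by exact_mod_cast h1
  exact (sq_eq_sq₀ (norm_nonneg _) (norm_nonneg _)).1 h2

/-- Every element of the bicommutant is approximated on `Ψ`, together with its adjoint, by
elements of the algebra. -/
theorem exists_tendsto (h : IsReflectingVector P Ψ) {x : H →L[ℂ] H} (hx : x ∈ bicommutant P) :
    ∃ p : ℕ → H →L[ℂ] H, (∀ n, p n ∈ P) ∧
      Filter.Tendsto (fun n => p n Ψ) Filter.atTop (nhds (x Ψ)) ∧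
      Filter.Tendsto (fun n => star (p n) Ψ) Filter.atTop (nhds (star x Ψ)) := by
  obtain ⟨s, hs, hlim⟩ := mem_closure_iff_seq_limit.1 (apply_mem_closure hx Ψ)
  choose p hp hps using hs
  obtain rfl : (fun n => p n Ψ) = s := funext hps
  refine ⟨p, hp, hlim, ?_⟩
  -- On `P` the adjoint is isometric for `‖· Ψ‖`, so the adjoints converge along with the operators.
  -- The limit is then identified by testing against the dense set `P' Ψ`.
  have hdist : ∀ m n, dist (star (p m) Ψ) (star (p n) Ψ) = dist (p m Ψ) (p n Ψ) := by
    intro m n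
    rw [dist_eq_norm, dist_eq_norm, ← sub_apply, ← sub_apply, ← star_sub,
      h.norm_star_apply (sub_mem (hp m) (hp n))]
  have hcau : CauchySeq fun n => star (p n) Ψ := by
    have := hlim.cauchySeq
    rw [Metric.cauchySeq_iff] at this ⊢
    simpa only [hdist] using this
  obtain ⟨η, hη⟩ := cauchySeq_tendsto_of_complete hcau
  suffices hηx : η = star x Ψ from hηx ▸ hη
  refine ext_inner_right ℂ fun ξ => ?_
  refine congrFun (Continuous.ext_on h.cyclic (f := fun ξ => inner ℂ η ξ)
    (g := fun ξ => inner ℂ (star x Ψ) ξ) (by fun_prop) (by fun_prop) ?_) ξ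
  rintro _ ⟨y, hy, rfl⟩
  have key : ∀ z ∈ bicommutant P, inner ℂ (star z Ψ) (y Ψ) = inner ℂ (star y Ψ) (z Ψ) := by
    intro z hz
    have h3 := congrArg (fun T => T Ψ) (mem_bicommutant.1 hz y hy)
    change y (z Ψ) = z (y Ψ) at h3
    rw [← inner_apply_eq_star, ← h3, inner_apply_eq_star]
  refine tendsto_nhds_unique (hη.inner tendsto_const_nhds) ?_
  change Filter.Tendsto _ _ (nhds (inner ℂ (star x Ψ) (y Ψ)))
  rw [key x hx]
  simp only [fun n => key (p n) (le_bicommutant P (hp n))]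
  exact tendsto_const_nhds.inner hlim

theorem tracial (h : IsReflectingVector P Ψ) {x y : H →L[ℂ] H} (hx : x ∈ bicommutant P)
    (hy : y ∈ bicommutant P) : inner ℂ Ψ (x (y Ψ)) = inner ℂ Ψ (y (x Ψ)) := by
  obtain ⟨p, hp, h1, h2⟩ := h.exists_tendsto hy
  rw [inner_apply_eq_star x Ψ (y Ψ),
    inner_apply_eq_star y Ψ (x Ψ)]
  refine tendsto_nhds_unique (tendsto_const_nhds.inner h1)
    (Filter.Tendsto.congr (fun n => ?_) (h2.inner tendsto_const_nhds))
  rw [← inner_apply_eq_star, ← inner_apply_eq_star, h.inner_mul_comm hx (hp n)]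

open scoped ComplexOrder in
theorem isTracialState (h : IsReflectingVector P Ψ) {S : StarSubalgebra ℂ (H →L[ℂ] H)}
    (hS : S ≤ (bicommutant P).toStarSubalgebra) : IsTracialState (vectorFunctional Ψ S) where
  nonneg x := by
    change 0 ≤ inner ℂ Ψ (star (x : H →L[ℂ] H) ((x : H →L[ℂ] H) Ψ))
    rw [inner_star_apply, inner_self_eq_norm_sq_to_K]
    rw [← RCLike.ofReal_pow]
    exact Complex.zero_le_real.2 (sq_nonneg ‖(x : H →L[ℂ] H) Ψ‖)
  one := h.inner_self
  tracial x y := h.tracial (hS x.2) (hS y.2)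

/-- If `v* v = 1`, the projection `1 - v v*` has trace zero, hence kills the separating vector `Ψ`.
-/
theorem isFiniteVN (h : IsReflectingVector P Ψ) : IsFiniteVN (bicommutant P) := by
  intro v hv hv1
  have hs : star v ∈ bicommutant P := star_mem hv
  have hq : 1 - v * star v ∈ bicommutant P := sub_mem (one_mem _) (mul_mem hv hs)
  refine (sub_eq_zero.1 (h.separating hq ?_)).symm
  have hsq : star (1 - v * star v) * (1 - v * star v) = 1 - v * star v := by
    have : v * star v * (v * star v) = v * star v := by
      rw [mul_assoc, ← mul_assoc (star v), hv1, one_mul]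
    rw [star_sub, star_one, star_mul, star_star, sub_mul, one_mul, mul_sub, mul_one, this,
      sub_self, sub_zero]
  have h1 := h.tracial hv hs
  have h2 : inner ℂ Ψ ((1 - v * star v) Ψ) = (0 : ℂ) := by
    change inner ℂ Ψ (Ψ - v (star v Ψ)) = (0 : ℂ)
    rw [inner_sub_right, h1]
    change _ - inner ℂ Ψ ((star v * v) Ψ) = _
    rw [hv1]
    exact sub_self _
  rw [← hsq] at h2
  change inner ℂ Ψ (star (1 - v * star v) ((1 - v * star v) Ψ)) = (0 : ℂ) at h2
  rwa [inner_star_apply, inner_self_eq_zero] at h2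

end IsReflectingVector

theorem isNormalFunctional_vectorFunctional (Ψ : H) (S : StarSubalgebra ℂ (H →L[ℂ] H)) :
    IsNormalFunctional (vectorFunctional Ψ S) := by
  have hs : Summable fun n : ℕ => ‖(Pi.single 0 Ψ : ℕ → H) n‖ ^ 2 :=
    summable_of_ne_finset_zero (s := {0}) fun n hn => by
      rw [Pi.single_eq_of_ne (by simpa using hn)]
      simp
  refine ⟨Pi.single 0 Ψ, Pi.single 0 Ψ, hs, hs, fun x => ?_⟩
  have := hasSum_single (f := fun n : ℕ => inner ℂ ((Pi.single 0 Ψ : ℕ → H) n)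
    ((x : H →L[ℂ] H) ((Pi.single 0 Ψ : ℕ → H) n))) 0 fun n hn => by
      rw [Pi.single_eq_of_ne hn, inner_zero_left]
  simpa [vectorFunctional] using this

end TracialVector

/-! ### Matrix units and anticommuting unitaries -/

section MatrixUnits

variable {K : Type u} [NormedAddCommGroup K] [InnerProductSpace ℂ K] {d : ℕ}

/-- Each term is `E_ij g E_ji = g_jj E_ii`. Together with the next lemma, which treats the factors
in cyclically permuted order, this expresses a trace on a matrix algebra through the diagonal sum.
-/
theorem sum_rankOne_mul_mul_rankOne (b : OrthonormalBasis (Fin d) ℂ K) (g : K →L[ℂ] K) :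
    ∑ i, ∑ j, InnerProductSpace.rankOne ℂ (b i) (b j) * g *
      InnerProductSpace.rankOne ℂ (b j) (b i) = (∑ j, inner ℂ (b j) (g (b j))) • 1 := by
  ext z
  have h : ∀ i j, (InnerProductSpace.rankOne ℂ (b i) (b j) * g *
      InnerProductSpace.rankOne ℂ (b j) (b i)) z =
      inner ℂ (b j) (g (b j)) • inner ℂ (b i) z • b i := fun i j => by
    change inner ℂ (b j) (g (inner ℂ (b i) z • b j)) • b i = _
    rw [map_smul, inner_smul_right, mul_comm, mul_smul]
  simp only [sum_apply, h, ← Finset.sum_smul, ← Finset.smul_sum, b.sum_repr']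
  rfl

theorem sum_rankOne_mul_rankOne (b : OrthonormalBasis (Fin d) ℂ K) :
    ∑ i, ∑ j, InnerProductSpace.rankOne ℂ (b j) (b i) *
      InnerProductSpace.rankOne ℂ (b i) (b j) = (d : ℂ) • (1 : K →L[ℂ] K) := by
  ext z
  have h : ∀ i j, (InnerProductSpace.rankOne ℂ (b j) (b i) *
      InnerProductSpace.rankOne ℂ (b i) (b j)) z = inner ℂ (b j) z • b j := fun i j => by
    change inner ℂ (b i) (inner ℂ (b j) z • b i) • b j = _
    rw [inner_smul_right, b.inner_eq_one, mul_one]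
  simp only [sum_apply, h, b.sum_repr']
  simp [Nat.cast_smul_eq_nsmul]

/-- In dimension at least two there are two self-adjoint unitaries that anticommute up to a
one-dimensional subspace; in particular the trace of `u v u v` is not positive. -/
theorem exists_selfAdjoint_unitaries [CompleteSpace K] (b : OrthonormalBasis (Fin d) ℂ K)
    (hd : 2 ≤ d) : ∃ u v : K →L[ℂ] K, star u = u ∧ u * u = 1 ∧ star v = v ∧ v * v = 1 ∧
      (∑ j, inner ℂ (b j) ((u * v * u * v) (b j))).re ≤ 0 := by
  -- `u` reverses the order of the basis and `v` has sign `1` on the first half (middle index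
  -- included), `-1` on the rest. Then `u v u v` multiplies `b j` by `s j * s j.rev`, which is `-1`
  -- except at a middle index fixed by reversal.
  let s : Fin d → ℝ := fun i => if i ≤ i.rev then 1 else -1
  let u : K →L[ℂ] K := ∑ i, InnerProductSpace.rankOne ℂ (b i.rev) (b i)
  let v : K →L[ℂ] K := ∑ i, (s i : ℂ) • InnerProductSpace.rankOne ℂ (b i) (b i)
  have hu : ∀ j, u (b j) = b j.rev := fun j => by
    simp [u, b.inner_eq_ite]
  have hv : ∀ j, v (b j) = (s j : ℂ) • b j := fun j => by
    simp [v, b.inner_eq_ite]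
  have hss : ∀ j, (s j : ℂ) * s j = 1 := fun j => by
    simp only [s]; split_ifs <;> simp
  have hext : ∀ {S T : K →L[ℂ] K}, (∀ j, S (b j) = T (b j)) → S = T := fun {S T} hST =>
    ContinuousLinearMap.coe_injective (b.toBasis.ext fun j => by simpa using hST j)
  refine ⟨u, v, ?_, hext fun j => ?_, ?_, hext fun j => ?_, ?_⟩
  · simp only [u, star_sum, ContinuousLinearMap.star_eq_adjoint,
      InnerProductSpace.adjoint_rankOne]
    exact Fintype.sum_equiv Fin.revPerm _ _ fun i => by simp
  · change u (u (b j)) = b j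
    rw [hu, hu, Fin.rev_rev]
  · simp [v, star_sum, ContinuousLinearMap.star_eq_adjoint]
  · change v (v (b j)) = b j
    rw [hv, map_smul, hv, smul_smul, hss, one_smul]
  · have h1 : ∀ j, inner ℂ (b j) ((u * v * u * v) (b j)) = ((s j * s j.rev : ℝ) : ℂ) := fun j => by
      change inner ℂ (b j) (u (v (u (v (b j))))) = _
      rw [hv, map_smul, hu, map_smul, hv, map_smul, map_smul, hu, Fin.rev_rev, smul_smul,
        inner_smul_right, b.inner_eq_one, mul_one]
      push_cast
      rfl
    simp only [h1]
    rw [← Complex.ofReal_sum, Complex.ofReal_re]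
    have h2 : ∀ j : Fin d, s j * s j.rev = if j = j.rev then 1 else -1 := fun j => by
      simp only [s, Fin.rev_rev]
      rcases lt_trichotomy j j.rev with h | h | h
      · rw [if_pos h.le, if_neg h.not_ge, if_neg h.ne]; norm_num
      · rw [← h]; simp
      · rw [if_neg h.not_ge, if_pos h.le, if_neg h.ne']; norm_num
    simp only [h2]
    -- Reversal has at most one fixed index, so `2 ≤ d` leaves at least one index contributing `-1`,
    -- enough to cancel it.
    have h3 : (Finset.univ.filter fun j : Fin d => j = j.rev).card ≤ 1 := by
      refine Finset.card_le_one.2 fun a ha c hc => ?_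
      simp only [Finset.mem_filter, Finset.mem_univ, true_and, Fin.ext_iff, Fin.val_rev] at ha hc
      ext
      omega
    have h4 := Finset.card_filter_add_card_filter_not (s := Finset.univ)
      (fun j : Fin d => j = j.rev)
    rw [Finset.card_univ, Fintype.card_fin] at h4
    rw [Finset.sum_ite, Finset.sum_const, Finset.sum_const]
    simp only [nsmul_eq_mul, mul_one, mul_neg]
    have h5 : (Finset.univ.filter fun j : Fin d => j = j.rev).card ≤
      (Finset.univ.filter fun j : Fin d => ¬ j = j.rev).card := by omega
    have h6 : ((Finset.univ.filter fun j : Fin d => j = j.rev).card : ℝ) ≤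
      (Finset.univ.filter fun j : Fin d => ¬ j = j.rev).card := by exact_mod_cast h5
    linarith

end MatrixUnits

/-! ### Products of commuting subalgebras -/

section Span

variable {A : Type u} [Ring A] [StarRing A] [Algebra ℂ A] [StarModule ℂ A]

theorem mem_span_mul_of_mem_sup {S T : StarSubalgebra ℂ A}
    (hST : ∀ s ∈ S, ∀ t ∈ T, Commute s t) {x : A} (hx : x ∈ S ⊔ T) :
    x ∈ Submodule.span ℂ {y | ∃ s ∈ S, ∃ t ∈ T, s * t = y} := by
  change x ∈ StarAlgebra.adjoin ℂ ((S : Set A) ∪ T) at hx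
  induction hx using StarAlgebra.adjoin_induction with
  | mem x hx =>
    rcases hx with hx | hx
    · exact Submodule.subset_span ⟨x, hx, 1, one_mem T, mul_one x⟩
    · exact Submodule.subset_span ⟨1, one_mem S, x, hx, one_mul x⟩
  | algebraMap c =>
    exact Submodule.subset_span ⟨algebraMap ℂ A c, S.algebraMap_mem c, 1, one_mem T, mul_one _⟩
  | add x y _ _ hx hy => exact add_mem hx hy
  | mul x y _ _ hx hy =>
    have hxy := Submodule.mul_mem_mul hx hy
    rw [Submodule.span_mul_span] at hxy
    refine Submodule.span_mono ?_ hxy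
    rintro _ ⟨_, ⟨s, hs, t, ht, rfl⟩, _, ⟨s', hs', t', ht', rfl⟩, rfl⟩
    refine ⟨s * s', mul_mem hs hs', t * t', mul_mem ht ht', ?_⟩
    change s * s' * (t * t') = s * t * (s' * t')
    rw [mul_assoc, mul_assoc, ← mul_assoc s', (hST s' hs' t ht).eq, mul_assoc]
  | star x hmem hx =>
    clear hmem
    induction hx using Submodule.span_induction with
    | mem x hx =>
      obtain ⟨s, hs, t, ht, rfl⟩ := hx
      refine Submodule.subset_span ⟨star s, star_mem hs, star t, star_mem ht, ?_⟩
      rw [(hST s hs t ht).eq, star_mul]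
    | zero => rw [star_zero]; exact zero_mem _
    | add x y _ _ hx hy => rw [star_add]; exact add_mem hx hy
    | smul c x _ hx => rw [star_smul]; exact Submodule.smul_mem _ _ hx

end Span

/-! ### Factorization of the trace over legs, and factoriality -/

section Legs

variable {H : Type u} [NormedAddCommGroup H] [InnerProductSpace ℂ H] [CompleteSpace H]
  {K : ℕ → FinHilb.{u}}

/-- The `*`-algebra generated by the first `n` of a sequence of represented matrix algebras. -/
noncomputable def legsBelow (r : ∀ k, (K k →L[ℂ] K k) →⋆ₐ[ℂ] (H →L[ℂ] H)) (n : ℕ) :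
    StarSubalgebra ℂ (H →L[ℂ] H) :=
  ⨆ k, ⨆ (_ : k < n), (r k).range

variable {r : ∀ k, (K k →L[ℂ] K k) →⋆ₐ[ℂ] (H →L[ℂ] H)} {Ψ : H}

theorem legsBelow_zero : legsBelow r 0 = ⊥ := by simp [legsBelow]

theorem legsBelow_succ (n : ℕ) : legsBelow r (n + 1) = legsBelow r n ⊔ (r n).range :=
  Nat.iSup_lt_succ (fun k => (r k).range) n

theorem legsBelow_le (n : ℕ) : legsBelow r n ≤ ⨆ k, (r k).range :=
  iSup_le fun k => iSup_le fun _ => le_iSup (fun k => (r k).range) k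

theorem legsBelow_mono : Monotone (legsBelow r) := fun _ _ hmn =>
  iSup_le fun k => iSup_le fun hk =>
    le_iSup₂_of_le (f := fun k _ => (r k).range) k (hk.trans_le hmn) le_rfl

theorem exists_mem_legsBelow {x : H →L[ℂ] H} (hx : x ∈ ⨆ k, (r k).range) :
    ∃ n, x ∈ legsBelow r n := by
  have h : (⨆ k, (r k).range) ≤ ⨆ n, legsBelow r n := iSup_le fun k =>
    le_iSup_of_le (k + 1) (legsBelow_succ (r := r) k ▸ le_sup_right)
  have h2 := h hx
  rw [← SetLike.mem_coe, StarSubalgebra.coe_iSup_of_directed legsBelow_mono.directed_le] at h2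
  simpa using h2

theorem commute_legsBelow (hr : ∀ k l, k ≠ l → ∀ a b, Commute (r k a) (r l b)) {n k : ℕ}
    (hk : n ≤ k) (a : K k →L[ℂ] K k) {x : H →L[ℂ] H} (hx : x ∈ legsBelow r n) :
    Commute x (r k a) := by
  have h : legsBelow r n ≤ StarSubalgebra.centralizer ℂ ((r k).range : Set (H →L[ℂ] H)) := by
    refine iSup_le fun l => iSup_le fun hl => ?_
    rintro _ ⟨b, rfl⟩
    refine mem_centralizer_coe.2 ?_
    rintro _ ⟨c, rfl⟩
    exact hr k l (by omega) c b
  exact ((mem_centralizer_coe.1 (h hx)) _ ⟨a, rfl⟩).symm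

/-- The functional `y ↦ ⟨Ψ, z y Ψ⟩`. -/
noncomputable def weightedFunctional (Ψ : H) (z : H →L[ℂ] H) : (H →L[ℂ] H) →ₗ[ℂ] ℂ where
  toFun y := inner ℂ Ψ (z (y Ψ))
  map_add' x y := by simp
  map_smul' c x := by simp

namespace IsReflectingVector

variable {P : StarSubalgebra ℂ (H →L[ℂ] H)}

section SingleLeg

variable {L : FinHilb.{u}} {ρ : (L →L[ℂ] L) →⋆ₐ[ℂ] (H →L[ℂ] H)}

/-- A central weight on the trace is tracial. -/
theorem weightedFunctional_tracial (h : IsReflectingVector P Ψ) {z : H →L[ℂ] H}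
    (hz : z ∈ bicommutant P) (hzc : ∀ y ∈ bicommutant P, Commute z y) {x y : H →L[ℂ] H}
    (hx : x ∈ bicommutant P) (hy : y ∈ bicommutant P) :
    weightedFunctional Ψ z (x * y) = weightedFunctional Ψ z (y * x) := by
  have h1 := h.tracial hx (mul_mem hz hy)
  have h2 : z * (x * y) = x * (z * y) := by rw [← mul_assoc, (hzc x hx).eq, mul_assoc]
  have h3 := congrArg (fun T => inner ℂ Ψ (T Ψ)) h2
  exact h3.trans h1

/-- Apply the functional to `∑ E_ij (g w E_ji)` and to its cyclic rearrangement `∑ (g w E_ji) E_ij`.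
Traciality equates them; since `w` commutes with the matrix units, the first is the diagonal sum of
`g` times `w`, the second is `d • g w`. -/
theorem natCast_mul_weightedFunctional (h : IsReflectingVector P Ψ)
    (hρ : ∀ a, ρ a ∈ bicommutant P) {d : ℕ} (b : OrthonormalBasis (Fin d) ℂ L) {z : H →L[ℂ] H}
    (hz : z ∈ bicommutant P) (hzc : ∀ y ∈ bicommutant P, Commute z y) (g : L →L[ℂ] L)
    {w : H →L[ℂ] H} (hw : w ∈ bicommutant P) (hwc : ∀ a, Commute (ρ a) w) :
    d * weightedFunctional Ψ z (ρ g * w) =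
      (∑ j, inner ℂ (b j) (g (b j))) * weightedFunctional Ψ z w := by
  let m : Fin d → Fin d → L →L[ℂ] L := fun i j => InnerProductSpace.rankOne ℂ (b i) (b j)
  have h1 : ∑ i, ∑ j, ρ (m i j) * (ρ g * w * ρ (m j i)) =
      (∑ j, inner ℂ (b j) (g (b j))) • w := by
    have h3 : ∀ i j, ρ (m i j) * (ρ g * w * ρ (m j i)) = ρ (m i j * g * m j i) * w := by
      intro i j
      rw [mul_assoc, ← (hwc (m j i)).eq, ← mul_assoc, ← mul_assoc, ← map_mul, ← map_mul]
    simp only [h3, ← Finset.sum_mul, ← map_sum]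
    rw [sum_rankOne_mul_mul_rankOne, map_smul, map_one, smul_mul_assoc, one_mul]
  have h2 : ∑ i, ∑ j, ρ g * w * ρ (m j i) * ρ (m i j) = (d : ℂ) • (ρ g * w) := by
    simp only [mul_assoc (ρ g * w), ← map_mul, ← Finset.mul_sum, ← map_sum]
    rw [sum_rankOne_mul_rankOne, map_smul, map_one, mul_smul_comm, mul_one]
  have h4 := congrArg (weightedFunctional Ψ z) h1
  have h5 := congrArg (weightedFunctional Ψ z) h2
  simp only [map_sum, map_smul, smul_eq_mul] at h4 h5
  rw [← h4, ← h5]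
  refine Finset.sum_congr rfl fun i _ => Finset.sum_congr rfl fun j _ => ?_
  exact h.weightedFunctional_tracial hz hzc (mul_mem (mul_mem (hρ g) hw) (hρ _)) (hρ _)

theorem natCast_mul_inner (h : IsReflectingVector P Ψ) (hρ : ∀ a, ρ a ∈ bicommutant P) {d : ℕ}
    (b : OrthonormalBasis (Fin d) ℂ L) (g : L →L[ℂ] L) :
    d * inner ℂ Ψ (ρ g Ψ) = ∑ j, inner ℂ (b j) (g (b j)) := by
  have h1 := h.natCast_mul_weightedFunctional hρ b (one_mem _)
    (fun y _ => Commute.one_left y) g (one_mem _) fun a => Commute.one_right _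
  rw [mul_one] at h1
  change d * inner ℂ Ψ (ρ g Ψ) = _ * inner ℂ Ψ Ψ at h1
  rwa [h.inner_self, mul_one] at h1

/-- A unital representation on a nonzero space forces `L ≠ 0`; this permits division by the
dimension. -/
theorem finrank_ne_zero (h : IsReflectingVector P Ψ) (ρ : (L →L[ℂ] L) →⋆ₐ[ℂ] (H →L[ℂ] H)) :
    Module.finrank ℂ L ≠ 0 := by
  intro h0
  have : Subsingleton L := Module.finrank_zero_iff.1 h0
  have h1 : (1 : L →L[ℂ] L) = 0 := by ext x; exact Subsingleton.elim _ _
  have h2 := congrArg (fun T => T Ψ) ((map_one ρ).symm.trans ((congrArg ρ h1).trans (map_zero ρ)))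
  exact h.ne_zero h2

theorem weightedFunctional_leg_mul (h : IsReflectingVector P Ψ)
    (hρ : ∀ a, ρ a ∈ bicommutant P) {z : H →L[ℂ] H}
    (hz : z ∈ bicommutant P) (hzc : ∀ y ∈ bicommutant P, Commute z y) (g : L →L[ℂ] L)
    {w : H →L[ℂ] H} (hw : w ∈ bicommutant P) (hwc : ∀ a, Commute (ρ a) w) :
    weightedFunctional Ψ z (ρ g * w) = inner ℂ Ψ (ρ g Ψ) * weightedFunctional Ψ z w := by
  have h1 := h.natCast_mul_weightedFunctional hρ (stdOrthonormalBasis ℂ L) hz hzc g hw hwc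
  rw [← h.natCast_mul_inner hρ (stdOrthonormalBasis ℂ L) g, mul_assoc] at h1
  exact mul_left_cancel₀ (Nat.cast_ne_zero.2 (h.finrank_ne_zero ρ)) h1

/-- The trace is multiplicative on commuting elements, one of which is in a matrix algebra. -/
theorem inner_leg_mul (h : IsReflectingVector P Ψ)
    (hρ : ∀ a, ρ a ∈ bicommutant P) (g : L →L[ℂ] L)
    {w : H →L[ℂ] H} (hw : w ∈ bicommutant P) (hwc : ∀ a, Commute (ρ a) w) :
    inner ℂ Ψ (ρ g (w Ψ)) = inner ℂ Ψ (ρ g Ψ) * inner ℂ Ψ (w Ψ) :=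
  h.weightedFunctional_leg_mul hρ (one_mem _) (fun y _ => Commute.one_left y) g hw hwc

end SingleLeg

variable (h : IsReflectingVector (⨆ k, (r k).range) Ψ)
  (hr : ∀ k l, k ≠ l → ∀ a b, Commute (r k a) (r l b))

theorem leg_mem (k : ℕ) (a : K k →L[ℂ] K k) : r k a ∈ bicommutant (⨆ k, (r k).range) :=
  le_bicommutant _ (le_iSup (fun k => (r k).range) k ⟨a, rfl⟩)

include h hr

/-- Induction on the number of legs: write `x` as a combination of `s * r n g` with `s` in the first
`n` legs, absorb `r n g` into `w` to use the induction hypothesis for `s`, then split off the single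
leg `n`. The general `w` is what lets the induction run; `z = 1` gives multiplicativity of the trace
itself. -/
theorem weightedFunctional_legsBelow {z : H →L[ℂ] H}
    (hz : z ∈ bicommutant (⨆ k, (r k).range))
    (hzc : ∀ y ∈ bicommutant (⨆ k, (r k).range), Commute z y) (n : ℕ) {x : H →L[ℂ] H}
    (hx : x ∈ legsBelow r n) {w : H →L[ℂ] H} (hw : w ∈ bicommutant (⨆ k, (r k).range))
    (hwc : ∀ k < n, ∀ a, Commute (r k a) w) :
    weightedFunctional Ψ z (x * w) = inner ℂ Ψ (x Ψ) * weightedFunctional Ψ z w := by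
  induction n generalizing x w with
  | zero =>
    rw [legsBelow_zero] at hx
    obtain ⟨c, rfl⟩ := hx
    change weightedFunctional Ψ z (algebraMap ℂ _ c * w) = 
      inner ℂ Ψ (algebraMap ℂ (H →L[ℂ] H) c Ψ) * _
    rw [Algebra.algebraMap_eq_smul_one, smul_mul_assoc, one_mul, map_smul]
    change _ = inner ℂ Ψ (c • Ψ) * _
    rw [inner_smul_right, h.inner_self, mul_one, smul_eq_mul]
  | succ n ih =>
    rw [legsBelow_succ] at hx
    have hx' := mem_span_mul_of_mem_sup (fun s hs t ht => by
      obtain ⟨a, rfl⟩ := ht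
      exact commute_legsBelow hr le_rfl a hs) hx
    clear hx
    induction hx' using Submodule.span_induction with
    | mem x hx =>
      obtain ⟨s, hs, _, ⟨g, rfl⟩, rfl⟩ := hx
      have hgw : ∀ k < n, ∀ a, Commute (r k a) (r n g * w) := fun k hk a =>
        (hr k n hk.ne a g).mul_right (hwc k (hk.trans n.lt_succ_self) a)
      have h1 := ih hs (mul_mem (leg_mem n g) hw) hgw
      have h2 := h.weightedFunctional_leg_mul (leg_mem n) hz hzc g hw (hwc n n.lt_succ_self)
      have h3 : inner ℂ Ψ (r n g (s Ψ)) = inner ℂ Ψ (r n g Ψ) * inner ℂ Ψ (s Ψ) :=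
        h.inner_leg_mul (leg_mem n) g (le_bicommutant _ (legsBelow_le n hs)) fun a =>
          (commute_legsBelow hr le_rfl a hs).symm
      have h4 : (s * r n g) Ψ = r n g (s Ψ) :=
        congrArg (fun T => T Ψ) (commute_legsBelow hr le_rfl g hs).eq
      change weightedFunctional Ψ z (s * r n g * w) = inner ℂ Ψ ((s * r n g) Ψ) * _
      rw [h4, h3, mul_assoc, h1, h2]
      ring
    | zero => simp
    | add x y _ _ hx hy =>
      rw [add_mul, map_add, hx, hy, add_apply, inner_add_right, add_mul]
    | smul c x _ hx =>
      rw [smul_mul_assoc, map_smul, hx, smul_apply, inner_smul_right, smul_eq_mul, mul_assoc]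

theorem isFactor : IsFactor (bicommutant (⨆ k, (r k).range)) := by
  refine ⟨⟨Ψ, 0, h.ne_zero⟩, fun z hz hz' => ⟨inner ℂ Ψ (z Ψ), ?_⟩⟩
  have hzc : ∀ y ∈ bicommutant (⨆ k, (r k).range), Commute z y := fun y hy =>
    (VonNeumannAlgebra.mem_commutant_iff.1 hz' y hy).symm
  let c : ℂ := inner ℂ Ψ (z Ψ)
  have hc1 : c • (1 : H →L[ℂ] H) ∈ bicommutant (⨆ k, (r k).range) :=
    (bicommutant (⨆ k, (r k).range)).toStarSubalgebra.smul_mem (one_mem _) c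
  -- Factorization says that `(z - c)* Ψ` is orthogonal to `P Ψ`. It also lies in the closure of `P
  -- Ψ`, so it vanishes, and `Ψ` is separating.
  let y : H →L[ℂ] H := star (z - c • 1)
  have hy : y ∈ bicommutant (⨆ k, (r k).range) := star_mem (sub_mem hz hc1)
  have horth : ∀ ξ ∈ closure {ξ | ∃ p ∈ ⨆ k, (r k).range, p Ψ = ξ}, inner ℂ (y Ψ) ξ = 0 := by
    refine closure_minimal (t := {ξ | inner ℂ (y Ψ) ξ = 0}) ?_
      (isClosed_eq (by fun_prop) continuous_const)
    rintro _ ⟨p, hp, rfl⟩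
    obtain ⟨n, hn⟩ := exists_mem_legsBelow hp
    have h1 := h.weightedFunctional_legsBelow hr hz hzc n hn (one_mem _)
      fun _ _ _ => Commute.one_right _
    rw [mul_one] at h1
    change inner ℂ Ψ (z (p Ψ)) = inner ℂ Ψ (p Ψ) * c at h1
    change inner ℂ (y Ψ) (p Ψ) = 0
    rw [← inner_apply_eq_star]
    change inner ℂ Ψ (z (p Ψ) - c • p Ψ) = 0
    rw [inner_sub_right, inner_smul_right, h1, mul_comm, sub_self]
  have h0 := h.separating hy (inner_self_eq_zero.1 (horth _ (apply_mem_closure hy Ψ)))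
  exact sub_eq_zero.1 (star_eq_zero.1 h0)

end IsReflectingVector

end Legs

/-! ### Absence of abelian projections -/

section AbelianProjection

variable {H : Type u} [NormedAddCommGroup H] [InnerProductSpace ℂ H] [CompleteSpace H]
  {K : ℕ → FinHilb.{u}} {r : ∀ k, (K k →L[ℂ] K k) →⋆ₐ[ℂ] (H →L[ℂ] H)} {Ψ : H}

omit [CompleteSpace H] in
theorem norm_apply_le_of_norm_le_one {A : H →L[ℂ] H} (hA : ‖A‖ ≤ 1) (ξ : H) : ‖A ξ‖ ≤ ‖ξ‖ :=
  (A.le_opNorm ξ).trans (mul_le_of_le_one_left (norm_nonneg _) hA)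

theorem norm_le_one_of_selfAdjoint_unitary {u : H →L[ℂ] H} (hu : star u = u) (huu : u * u = 1) :
    ‖u‖ ≤ 1 := by
  have h1 : ‖u‖ * ‖u‖ ≤ 1 := by
    rw [← CStarRing.norm_star_mul_self, hu, huu]
    exact ContinuousLinearMap.norm_id_le
  nlinarith [norm_nonneg u]

namespace IsReflectingVector

section Estimates

variable {P : StarSubalgebra ℂ (H →L[ℂ] H)} (h : IsReflectingVector P Ψ)

include h

theorem norm_star_apply_of_mem {x : H →L[ℂ] H} (hx : x ∈ bicommutant P) :
    ‖star x Ψ‖ = ‖x Ψ‖ := by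
  have h1 := h.tracial hx (star_mem hx)
  rw [inner_apply_eq_star x, inner_star_apply x Ψ (x Ψ), inner_self_eq_norm_sq_to_K,
    inner_self_eq_norm_sq_to_K] at h1
  have h2 : ‖star x Ψ‖ ^ 2 = ‖x Ψ‖ ^ 2 := by exact_mod_cast h1
  exact (sq_eq_sq₀ (norm_nonneg _) (norm_nonneg _)).1 h2

/-- Right multiplication by a contraction is contractive for `‖· Ψ‖`: the trace allows passing to
adjoints, where it becomes left multiplication. -/
theorem norm_apply_apply_le {x b : H →L[ℂ] H} (hx : x ∈ bicommutant P) (hb : b ∈ bicommutant P)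
    (hb1 : ‖b‖ ≤ 1) : ‖x (b Ψ)‖ ≤ ‖x Ψ‖ := by
  have h1 := h.norm_star_apply_of_mem (mul_mem hx hb)
  rw [star_mul] at h1
  change ‖star b (star x Ψ)‖ = ‖x (b Ψ)‖ at h1
  rw [← h1, ← h.norm_star_apply_of_mem hx]
  exact norm_apply_le_of_norm_le_one ((norm_star b).trans_le hb1) _

/-- As `u` commutes with `x`, the commutator sees only `e - x`; each of its two terms costs `‖(e -
x) Ψ‖`. -/
theorem norm_commutator_le {e x u : H →L[ℂ] H} (he : e ∈ bicommutant P) (hx : x ∈ bicommutant P)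
    (hu : u ∈ bicommutant P) (hu1 : ‖u‖ ≤ 1) (hux : Commute x u) :
    ‖(e * u - u * e) Ψ‖ ≤ 2 * ‖(e - x) Ψ‖ := by
  have h1 : e * u - u * e = (e - x) * u - u * (e - x) := by
    rw [sub_mul, mul_sub, hux.eq]
    abel
  rw [h1, two_mul]
  exact (norm_sub_le _ _).trans (add_le_add (h.norm_apply_apply_le (sub_mem he hx) hu hu1)
    (norm_apply_le_of_norm_le_one hu1 _))

/-- A projection `e` close to an element that commutes with `u` and `v` almost commutes with
them. -/
theorem norm_compression_sub_le {e x u v : H →L[ℂ] H} (he : e ∈ bicommutant P)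
    (hep : IsStarProjection e) (hx : x ∈ bicommutant P)
    (hu : u ∈ bicommutant P) (hu1 : ‖u‖ ≤ 1) (hux : Commute x u)
    (hv : v ∈ bicommutant P) (hv1 : ‖v‖ ≤ 1) (hvx : Commute x v) :
    ‖(u * v * e - e * u * e * (e * v * e)) Ψ‖ ≤ 6 * ‖(e - x) Ψ‖ := by
  have he1 := hep.norm_le
  have hee : e * e = e := hep.isIdempotentElem.eq
  have hae := h.norm_commutator_le he hx hu hu1 hux
  have hbe := h.norm_commutator_le he hx hv hv1 hvx
  have hau : e * u - u * e ∈ bicommutant P := sub_mem (mul_mem he hu) (mul_mem hu he)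
  have hbv : e * v - v * e ∈ bicommutant P := sub_mem (mul_mem he hv) (mul_mem hv he)
  have hve1 : ‖v * e‖ ≤ 1 :=
    (norm_mul_le v e).trans (mul_le_one₀ hv1 (norm_nonneg _) he1)
  have heu1 : ‖e * u‖ ≤ 1 :=
    (norm_mul_le e u).trans (mul_le_one₀ he1 (norm_nonneg _) hu1)
  -- The difference telescopes into three terms, each with one commutator of `e` with `u` or `v`.
  -- Each is at most `2 ‖(e - x) Ψ‖` on `Ψ`, whence the constant `6`.
  have h1 : e * u * e * (e * v * e) - u * v * e =
      e * u * ((e * v - v * e) * e) + (e * u - u * e) * (v * e) +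
        u * ((e * v - v * e) * e) := by
    have e1 : e * u * e * (e * v * e) = e * u * (e * v * e) := by
      rw [mul_assoc (e * u), ← mul_assoc e (e * v), ← mul_assoc e e, hee]
    have e2 : (e * v - v * e) * e = e * v * e - v * e := by
      rw [sub_mul, mul_assoc v, hee]
    rw [e1, e2]
    noncomm_ring
  have b1 : ‖(e * v - v * e) (e Ψ)‖ ≤ 2 * ‖(e - x) Ψ‖ :=
    (h.norm_apply_apply_le hbv he he1).trans hbe
  have b2 : ‖(e * u - u * e) ((v * e) Ψ)‖ ≤ 2 * ‖(e - x) Ψ‖ :=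
    (h.norm_apply_apply_le hau (mul_mem hv he) hve1).trans hae
  rw [← neg_sub, h1, neg_apply, norm_neg]
  refine (norm_add₃_le (a := (e * u) ((e * v - v * e) (e Ψ)))
    (b := (e * u - u * e) ((v * e) Ψ)) (c := u ((e * v - v * e) (e Ψ)))).trans ?_
  have b3 := norm_apply_le_of_norm_le_one heu1 ((e * v - v * e) (e Ψ))
  have b4 := norm_apply_le_of_norm_le_one hu1 ((e * v - v * e) (e Ψ))
  linarith

/-- For self-adjoint unitaries `[u, v]* [u, v] = 2 - v u v u - u v u v`, and the last two terms have
the same trace, with nonpositive real part. -/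
theorem two_le_norm_sq_commutator {u v : H →L[ℂ] H} (hu : u ∈ bicommutant P)
    (hv : v ∈ bicommutant P) (hsu : star u = u) (huu : u * u = 1) (hsv : star v = v)
    (hvv : v * v = 1) (hneg : (inner ℂ Ψ ((u * v * u * v) Ψ)).re ≤ 0) :
    2 ≤ ‖(u * v - v * u) Ψ‖ ^ 2 := by
  have h1 : star (u * v - v * u) * (u * v - v * u) =
      (2 : ℂ) • 1 - v * (u * v * u) - u * v * u * v := by
    have e1 : v * u * (u * v) = 1 := by rw [mul_assoc, ← mul_assoc u, huu, one_mul, hvv]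
    have e2 : u * v * (v * u) = 1 := by rw [mul_assoc, ← mul_assoc v, hvv, one_mul, huu]
    rw [star_sub, star_mul, star_mul, hsu, hsv, sub_mul, mul_sub, mul_sub, e1, e2, two_smul]
    noncomm_ring
  have h2 : inner ℂ Ψ ((v * (u * v * u)) Ψ) = inner ℂ Ψ ((u * v * u * v) Ψ) :=
    h.tracial hv (mul_mem (mul_mem hu hv) hu)
  have h3 : inner ℂ Ψ ((star (u * v - v * u) * (u * v - v * u)) Ψ) =
      ((‖(u * v - v * u) Ψ‖ ^ 2 : ℝ) : ℂ) := by
    change inner ℂ Ψ (star (u * v - v * u) ((u * v - v * u) Ψ)) = _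
    rw [inner_star_apply, inner_self_eq_norm_sq_to_K]
    push_cast
    rfl
  rw [h1, sub_apply, sub_apply, inner_sub_right, inner_sub_right, h2] at h3
  change inner ℂ Ψ ((2 : ℂ) • Ψ) - _ - _ = _ at h3
  rw [inner_smul_right, h.inner_self] at h3
  have h4 := congrArg Complex.re h3
  rw [Complex.ofReal_re] at h4
  simp only [Complex.sub_re, mul_one] at h4
  rw [show (2 : ℂ).re = 2 from rfl] at h4
  linarith

end Estimates

variable (h : IsReflectingVector (⨆ k, (r k).range) Ψ)
  (hr : ∀ k l, k ≠ l → ∀ a b, Commute (r k a) (r l b))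

include h hr

/-- This is multiplicativity of the trace applied to `x* x` and `w* w`, since `(w x)* (w x) = x* x
w* w`. -/
theorem norm_sq_mul_legsBelow {n : ℕ} {x : H →L[ℂ] H} (hx : x ∈ legsBelow r n)
    {w : H →L[ℂ] H} (hw : w ∈ bicommutant (⨆ k, (r k).range))
    (hwx : ∀ y ∈ legsBelow r n, Commute y w) : ‖w (x Ψ)‖ ^ 2 = ‖x Ψ‖ ^ 2 * ‖w Ψ‖ ^ 2 := by
  have hlow : ∀ k < n, ∀ a, r k a ∈ legsBelow r n := fun k hk a =>
    le_iSup₂_of_le (f := fun k (_ : k < n) => (r k).range) k hk le_rfl ⟨a, rfl⟩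
  have hc : ∀ y ∈ legsBelow r n, Commute y (star w * w) := fun y hy =>
    Commute.mul_right (by simpa using (hwx _ (star_mem hy)).star_star) (hwx y hy)
  have h1 := h.weightedFunctional_legsBelow hr (one_mem _) (fun y _ => Commute.one_left y) n
    (mul_mem (star_mem hx) hx) (mul_mem (star_mem hw) hw) fun k hk a => hc _ (hlow k hk a)
  have h2 : star x * x * (star w * w) = star (w * x) * (w * x) := by
    rw [mul_assoc, (hc x hx).eq, star_mul]
    simp only [mul_assoc]
  have h3 : ∀ y : H →L[ℂ] H, inner ℂ Ψ ((star y * y) Ψ) = ((‖y Ψ‖ ^ 2 : ℝ) : ℂ) := fun y => by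
    change inner ℂ Ψ (star y (y Ψ)) = _
    rw [inner_star_apply, inner_self_eq_norm_sq_to_K]
    push_cast
    rfl
  rw [h2] at h1
  change inner ℂ Ψ ((star (w * x) * (w * x)) Ψ) = _ * inner ℂ Ψ ((star w * w) Ψ) at h1
  rw [h3, h3, h3] at h1
  exact_mod_cast h1

theorem eq_zero_of_isAbelianProjection
    (hdim : ∃ᶠ k in Filter.atTop, 2 ≤ Module.finrank ℂ (K k)) {e : H →L[ℂ] H}
    (he : IsAbelianProjection (bicommutant (⨆ k, (r k).range)) e) : e = 0 := by
  obtain ⟨heM, hep, hab⟩ := he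
  refine h.separating heM (norm_le_zero_iff.1 (le_of_forall_pos_le_add fun ε hε => ?_))
  rw [zero_add]
  obtain ⟨_, ⟨x, hxP, rfl⟩, hx⟩ :=
    -- The final estimate is `‖e Ψ‖ ≤ (14 + 1) ‖(e - x) Ψ‖`, hence `ε / 15`.
    Metric.mem_closure_iff.1 (apply_mem_closure heM Ψ) (ε / 15) (by positivity)
  rw [dist_eq_norm, ← sub_apply] at hx
  obtain ⟨n, hxn⟩ := exists_mem_legsBelow hxP
  obtain ⟨k, hk, hdk⟩ := Filter.frequently_atTop.1 hdim n
  obtain ⟨u₀, v₀, hsu, huu, hsv, hvv, hneg⟩ :=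
    exists_selfAdjoint_unitaries (stdOrthonormalBasis ℂ (K k)) hdk
  rw [← h.natCast_mul_inner (leg_mem k), ← Complex.ofReal_natCast, Complex.re_ofReal_mul] at hneg
  have hneg' := nonpos_of_mul_nonpos_right hneg (by positivity)
  have hxM := le_bicommutant _ hxP
  set u := r k u₀ with hu
  set v := r k v₀ with hv
  have huM := leg_mem (r := r) k u₀
  have hvM := leg_mem (r := r) k v₀
  have hsu' : star u = u := by rw [hu, ← map_star, hsu]
  have hsv' : star v = v := by rw [hv, ← map_star, hsv]
  have huu' : u * u = 1 := by rw [hu, ← map_mul, huu, map_one]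
  have hvv' : v * v = 1 := by rw [hv, ← map_mul, hvv, map_one]
  have hu1 := norm_le_one_of_selfAdjoint_unitary hsu' huu'
  have hv1 := norm_le_one_of_selfAdjoint_unitary hsv' hvv'
  have hcu : ∀ y ∈ legsBelow r n, Commute y u := fun y hy => commute_legsBelow hr hk u₀ hy
  have hcv : ∀ y ∈ legsBelow r n, Commute y v := fun y hy => commute_legsBelow hr hk v₀ hy
  have b1 := h.norm_compression_sub_le heM hep hxM huM hu1 (hcu x hxn) hvM hv1 (hcv x hxn)
  have b2 := h.norm_compression_sub_le heM hep hxM hvM hv1 (hcv x hxn) huM hu1 (hcu x hxn)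
  -- The abelian hypothesis enters here: `u v e` and `v u e` are both close, on `Ψ`, to the same
  -- operator, so `[u, v] e Ψ` has norm at most `(6 + 6) ‖(e - x) Ψ‖`.
  rw [← (hab u huM v hvM).eq] at b2
  have hD1 : ‖u * v - v * u‖ ≤ 2 := by
    refine (norm_sub_le _ _).trans ?_
    have c1 := (norm_mul_le u v).trans (mul_le_one₀ hu1 (norm_nonneg _) hv1)
    have c2 := (norm_mul_le v u).trans (mul_le_one₀ hv1 (norm_nonneg _) hu1)
    linarith
  have hDM : u * v - v * u ∈ bicommutant (⨆ k, (r k).range) :=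
    sub_mem (mul_mem huM hvM) (mul_mem hvM huM)
  have b3 : ‖(u * v - v * u) (e Ψ)‖ ≤ 12 * ‖(e - x) Ψ‖ := by
    have e1 : (u * v - v * u) (e Ψ) = (u * v * e - e * u * e * (e * v * e)) Ψ -
        (v * u * e - e * u * e * (e * v * e)) Ψ := by
      rw [← sub_apply, sub_sub_sub_cancel_right, ← sub_mul]
      rfl
    rw [e1]
    refine (norm_sub_le _ _).trans ?_
    linarith
  -- Replacing `e` by `x` costs `‖[u, v]‖ ≤ 2` times the distance, and `12 + 2 = 14`.
  have b4 : ‖(u * v - v * u) (x Ψ)‖ ≤ 14 * ‖(e - x) Ψ‖ := by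
    have e1 : (u * v - v * u) (x Ψ) = (u * v - v * u) (e Ψ) -
        (u * v - v * u) ((e - x) Ψ) := by
      rw [← map_sub, sub_apply e x, sub_sub_cancel]
    have e2 := ((u * v - v * u).le_opNorm ((e - x) Ψ)).trans
      (mul_le_mul_of_nonneg_right hD1 (norm_nonneg _))
    rw [e1]
    refine (norm_sub_le _ _).trans ?_
    linarith
  have b5 := h.norm_sq_mul_legsBelow hr hxn hDM fun y hy =>
    ((hcu y hy).mul_right (hcv y hy)).sub_right ((hcv y hy).mul_right (hcu y hy))
  have b6 := h.two_le_norm_sq_commutator huM hvM hsu' huu' hsv' hvv' (by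
    simpa only [hu, hv, map_mul] using hneg')
  have b7 : ‖x Ψ‖ ≤ ‖(u * v - v * u) (x Ψ)‖ := by
    refine (sq_le_sq₀ (norm_nonneg _) (norm_nonneg _)).1 ?_
    rw [b5]
    nlinarith [sq_nonneg ‖x Ψ‖]
  have b8 : ‖e Ψ‖ ≤ ‖(e - x) Ψ‖ + ‖x Ψ‖ := by
    refine le_trans (le_of_eq ?_) (norm_add_le _ _)
    rw [sub_apply, sub_add_cancel]
  linarith

theorem isTypeIIOne (hdim : ∃ᶠ k in Filter.atTop, 2 ≤ Module.finrank ℂ (K k)) :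
    IsTypeIIOne (bicommutant (⨆ k, (r k).range)) :=
  ⟨⟨Ψ, 0, h.ne_zero⟩, h.isFiniteVN, fun _ he => h.eq_zero_of_isAbelianProjection hr hdim he⟩

end IsReflectingVector

end AbelianProjection

open FinHilb

open FinHilb


/-! ### Commutation in the inductive limit -/

namespace RepSystem

variable {V : ℕ → Type u} [∀ n, NormedAddCommGroup (V n)] [∀ n, InnerProductSpace ℂ (V n)]
  [∀ n, CompleteSpace (V n)] {B : ℕ → Type v} [∀ n, CStarAlgebra (B n)]
  {γ : ∀ n, V n →ₗᵢ[ℂ] V (n + 1)} (S : RepSystem γ B)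

theorem limitRep_multiPush (m n : ℕ) (h : m ≤ n) (b : B m) :
    S.limitRep n (multiPush S.φ m n h b) = S.limitRep m b := by
  induction n, h using Nat.le_induction with
  | base => rw [multiPush_self]
  | succ n h ih => rw [multiPush_succ S.φ m n h, limitRep_push, ih]

/-- Two inductive systems of algebras that commute in every layer commute in the limit. -/
theorem commute_limitRep {B' : ℕ → Type v} [∀ n, CStarAlgebra (B' n)] (T : RepSystem γ B')
    (hST : ∀ n b c, Commute (S.ρ n b) (T.ρ n c)) (k l : ℕ) (b : B k) (c : B' l) :
    Commute (S.limitRep k b) (T.limitRep l c) := by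
  refine HilbertLimit.clm_ext (max k l) fun n hn ψ => ?_
  have hk : k ≤ n := (le_max_left k l).trans hn
  have hl : l ≤ n := (le_max_right k l).trans hn
  change S.limitRep k b (T.limitRep l c _) = T.limitRep l c (S.limitRep k b _)
  rw [S.limitRep_of k n hk, T.limitRep_of l n hl, S.limitRep_of k n hk, T.limitRep_of l n hl]
  exact congrArg (fun A => HilbertLimit.of γ n (A ψ)) (hST n _ _).eq

end RepSystem

/-! ### Transposition across a maximally entangled pair -/

namespace FinHilb

variable {E F G K : FinHilb.{u}}

theorem ampLeft_tmul (O : F →L[ℂ] F) (x : E) (y : F) :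
    ampLeft E F O (tmul x y) = tmul x (O y) := rfl

theorem smul_tmul (c : ℂ) (x : E) (y : F) : tmul (c • x) y = c • tmul x y :=
  TensorProduct.smul_tmul' c x y

theorem tmul_smul (c : ℂ) (x : E) (y : F) : tmul x (c • y) = c • tmul x y :=
  TensorProduct.tmul_smul c x y

theorem tensor_ext {S T : (E ⊠ F : FinHilb.{u}) →L[ℂ] (G : FinHilb.{u})}
    (h : ∀ x y, S (tmul x y) = T (tmul x y)) : S = T := by
  ext z
  induction z using tensor_induction with
  | zero => rw [map_zero, map_zero]
  | tmul x y => exact h x y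
  | add x y hx hy => rw [map_add, map_add, hx, hy]

theorem commute_ampRight_ampLeft (X : E →L[ℂ] E) (Y : F →L[ℂ] F) :
    Commute (ampRight E F X) (ampLeft E F Y) :=
  tensor_ext fun _ _ => rfl

/-- The map `x ⊗ ·`. -/
noncomputable def tmulLinear (x : E) : F →ₗ[ℂ] (E ⊠ F : FinHilb.{u}) := TensorProduct.mk ℂ E F x

theorem tmulLinear_apply (x : E) (y : F) : tmulLinear x y = tmul x y := rfl

section Transpose

variable {d : ℕ} (e : OrthonormalBasis (Fin d) ℂ E) (f : OrthonormalBasis (Fin d) ℂ F)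

/-- The transpose of an operator on `E`, as an operator on `F`, with respect to a pair of
orthonormal bases. -/
noncomputable def transposeOp (R : E →L[ℂ] E) : F →L[ℂ] F :=
  ∑ k, ∑ l, inner ℂ (e k) (R (e l)) • InnerProductSpace.rankOne ℂ (f l) (f k)

theorem transposeOp_apply (R : E →L[ℂ] E) (k : Fin d) :
    transposeOp e f R (f k) = ∑ l, inner ℂ (e k) (R (e l)) • f l := by
  simp [transposeOp, f.inner_eq_ite, ite_smul]

/-- Thanks to this compatibility, one transpose serves as the reflection of both `R` and `star R`.
-/
theorem star_transposeOp (R : E →L[ℂ] E) :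
    star (transposeOp e f R) = transposeOp e f (star R) := by
  simp only [transposeOp, star_sum, star_smul]
  rw [Finset.sum_comm]
  refine Finset.sum_congr rfl fun k _ => Finset.sum_congr rfl fun l _ => ?_
  rw [inner_star_apply, ContinuousLinearMap.star_eq_adjoint, InnerProductSpace.adjoint_rankOne]
  exact congrArg (· • _) (inner_conj_symm _ _)

/-- Both sides expand to `∑ ⟨e_k, R e_l⟩ e_k ⊗ f_l`. -/
theorem ampRight_sum_tmul (R : E →L[ℂ] E) :
    ampRight E F R (∑ k, tmul (e k) (f k)) =
      ampLeft E F (transposeOp e f R) (∑ k, tmul (e k) (f k)) := by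
  rw [map_sum, map_sum]
  simp only [ampRight_tmul, ampLeft_tmul, transposeOp_apply]
  have h1 : ∀ k, tmul (e k) (∑ l, inner ℂ (e k) (R (e l)) • f l) =
      ∑ l, inner ℂ (e k) (R (e l)) • tmul (e k) (f l) := fun k => by
    rw [← tmulLinear_apply, map_sum]
    simp only [tmulLinear_apply, tmul_smul]
  have h2 : ∀ l, tmul (R (e l)) (f l) = ∑ k, inner ℂ (e k) (R (e l)) • tmul (e k) (f l) :=
    fun l => by
      have h3 := congrArg (TensorProduct.mk ℂ E F |>.flip (f l)) (e.sum_repr' (R (e l)))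
      rw [map_sum] at h3
      exact h3.symm.trans (Finset.sum_congr rfl fun k _ => smul_tmul _ _ _)
  simp only [h1, h2]
  exact Finset.sum_comm

end Transpose

/-- Operators on one half of a maximally entangled pair are reflected to the other half. -/
theorem IsMaximallyEntangled.exists_reflection {χ : (E ⊠ F : FinHilb.{u})}
    (h : IsMaximallyEntangled χ) (R : E →L[ℂ] E) : ∃ R' : F →L[ℂ] F,
      ampRight E F R χ = ampLeft E F R' χ ∧ ampRight E F (star R) χ = ampLeft E F (star R') χ := by
  obtain ⟨d, -, e, f, rfl⟩ := h
  refine ⟨transposeOp e f R, ?_, ?_⟩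
  · rw [map_smul, map_smul, ampRight_sum_tmul]
  · rw [star_transposeOp, map_smul, map_smul, ampRight_sum_tmul]

end FinHilb

/-! ### Operators on the new legs of one side -/

namespace Wedge

variable (W : Wedge.{u})

/-- Operators on the degrees of freedom added by layer `k`, as operators on the boundary. -/
noncomputable def newOp : ∀ k, (W.New k →L[ℂ] W.New k) →⋆ₐ[ℂ] (W.bdy k →L[ℂ] W.bdy k)
  | 0 => conj W.U₀
  | k + 1 => (conj (W.U k)).comp (ampLeft (W.bdy k) (W.New (k + 1)))

theorem newOp_zero_apply (X : W.New 0 →L[ℂ] W.New 0) (x : W.New 0) :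
    W.newOp 0 X (W.U₀ x) = W.U₀ (X x) := conj_apply W.U₀ X x

theorem newOp_succ_apply (k : ℕ) (X : W.New (k + 1) →L[ℂ] W.New (k + 1))
    (x : (W.bdy k ⊠ W.New (k + 1) : FinHilb.{u})) :
    W.newOp (k + 1) X (W.U k x) = W.U k (ampLeft (W.bdy k) (W.New (k + 1)) X x) :=
  conj_apply (W.U k) _ x

/-- Before conjugation by the same unitary, the old boundary and the new legs are different tensor
factors. This is why RT legs of different layers commute. -/
theorem commute_push_newOp (k : ℕ) (X : W.bdy k →L[ℂ] W.bdy k)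
    (Y : W.New (k + 1) →L[ℂ] W.New (k + 1)) :
    Commute (W.push k X) (W.newOp (k + 1) Y) :=
  (commute_ampRight_ampLeft X Y).map (conj (W.U k))

theorem fill_apply (k : ℕ) (x : W.rt k) :
    W.fill k x = tmul (W.bulkState k) (tmul (W.ancState k) x) := rfl

theorem rtNew_fill (k : ℕ) (R : W.rt k →L[ℂ] W.rt k) (x : W.rt k) :
    W.rtNew k R (W.fill k x) = W.fill k (R x) := rfl

theorem commute_bulk_rtNew (k : ℕ) (X : W.bulk k →L[ℂ] W.bulk k) (R : W.rt k →L[ℂ] W.rt k) :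
    Commute (ampRight (W.bulk k) (W.anc k ⊠ W.rt k) X) (W.rtNew k R) :=
  commute_ampRight_ampLeft X _

theorem commute_anc_rtNew (k : ℕ) (X : W.anc k →L[ℂ] W.anc k) (R : W.rt k →L[ℂ] W.rt k) :
    Commute (ampLeft (W.bulk k) (W.anc k ⊠ W.rt k) (ampRight (W.anc k) (W.rt k) X))
      (W.rtNew k R) :=
  (commute_ampRight_ampLeft X R).map (ampLeft (W.bulk k) (W.anc k ⊠ W.rt k))

theorem rtAlgebra_zero : W.rtAlgebra 0 = ((W.newOp 0).comp (W.rtNew 0)).range := rfl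

theorem rtAlgebra_succ (k : ℕ) : W.rtAlgebra (k + 1) = (W.rtAlgebra k).map (W.push k) ⊔
    ((W.newOp (k + 1)).comp (W.rtNew (k + 1))).range := rfl

end Wedge

open FinHilb


/-! ### Reflection and cyclicity for the network state -/

namespace HolographicNetwork

variable (N : HolographicNetwork.{u})

section NewState

variable (k : ℕ)

theorem mapIsometry_tmul {E F G K : FinHilb.{u}} (f : E →ₗᵢ[ℂ] G) (g : F →ₗᵢ[ℂ] K) (x : E)
    (y : F) : mapIsometry f g (tmul x y) = tmul (f x) (g y) := rfl

theorem ampRight_rtNew_mapIsometry (R : N.A.rt k →L[ℂ] N.A.rt k)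
    (χ : (N.A.rt k ⊠ N.Ac.rt k : FinHilb.{u})) :
    ampRight (N.A.New k) (N.Ac.New k) (N.A.rtNew k R)
        (mapIsometry (N.A.fill k) (N.Ac.fill k) χ) =
      mapIsometry (N.A.fill k) (N.Ac.fill k) (ampRight (N.A.rt k) (N.Ac.rt k) R χ) := by
  induction χ using tensor_induction with
  | zero => simp only [map_zero]
  | add x y hx hy => simp only [map_add, hx, hy]
  | tmul x y => rw [mapIsometry_tmul, ampRight_tmul, ampRight_tmul, mapIsometry_tmul,
      Wedge.rtNew_fill]

theorem ampLeft_rtNew_mapIsometry (R : N.Ac.rt k →L[ℂ] N.Ac.rt k)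
    (χ : (N.A.rt k ⊠ N.Ac.rt k : FinHilb.{u})) :
    ampLeft (N.A.New k) (N.Ac.New k) (N.Ac.rtNew k R)
        (mapIsometry (N.A.fill k) (N.Ac.fill k) χ) =
      mapIsometry (N.A.fill k) (N.Ac.fill k) (ampLeft (N.A.rt k) (N.Ac.rt k) R χ) := by
  induction χ using tensor_induction with
  | zero => simp only [map_zero]
  | add x y hx hy => simp only [map_add, hx, hy]
  | tmul x y => rw [mapIsometry_tmul, ampLeft_tmul, ampLeft_tmul, mapIsometry_tmul,
      Wedge.rtNew_fill]

theorem exists_reflection_newState (R : N.A.rt k →L[ℂ] N.A.rt k) :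
    ∃ Y : N.Ac.New k →L[ℂ] N.Ac.New k,
      ampRight (N.A.New k) (N.Ac.New k) (N.A.rtNew k R) (N.newState k) =
          ampLeft (N.A.New k) (N.Ac.New k) Y (N.newState k) ∧
        ampRight (N.A.New k) (N.Ac.New k) (N.A.rtNew k (star R)) (N.newState k) =
          ampLeft (N.A.New k) (N.Ac.New k) (star Y) (N.newState k) := by
  obtain ⟨R', h1, h2⟩ := (N.rtState_maxEntangled k).exists_reflection R
  refine ⟨N.Ac.rtNew k R', ?_, ?_⟩
  · rw [newState, ampRight_rtNew_mapIsometry, ampLeft_rtNew_mapIsometry, h1]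
  · rw [← map_star, newState, ampRight_rtNew_mapIsometry, ampLeft_rtNew_mapIsometry, h2]

/-- The state of the new degrees of freedom is cyclic for the operators on the complementary side
together with those on side `A` that commute with the RT legs. -/
theorem newState_cyclic (L : Submodule ℂ (N.A.New k ⊠ N.Ac.New k : FinHilb.{u}))
    (h0 : N.newState k ∈ L)
    (hX : ∀ X, (∀ R, Commute X (N.A.rtNew k R)) →
      ∀ θ ∈ L, ampRight (N.A.New k) (N.Ac.New k) X θ ∈ L)
    (hY : ∀ Y, ∀ θ ∈ L, ampLeft (N.A.New k) (N.Ac.New k) Y θ ∈ L)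
    (θ : (N.A.New k ⊠ N.Ac.New k : FinHilb.{u})) : θ ∈ L := by
  obtain ⟨d, hd, e, f, hχ⟩ := N.rtState_maxEntangled k
  have h1 : ∑ i, tmul (N.A.fill k (e i)) (N.Ac.fill k (f i)) ∈ L := by
    have h2 : N.newState k = ((√(d : ℝ) : ℝ) : ℂ)⁻¹ •
        ∑ i, tmul (N.A.fill k (e i)) (N.Ac.fill k (f i)) := by
      rw [newState, hχ, map_smul, map_sum]
      rfl
    rw [h2] at h0
    refine (Submodule.smul_mem_iff L (inv_ne_zero ?_)).1 h0
    exact_mod_cast (Real.sqrt_pos.2 (Nat.cast_pos.2 hd)).ne'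
  -- A rank-one operator on the complement selects the term `i` of the entangled sum and replaces `f
  -- i` by an arbitrary `n`. The basis vectors `e i` of the RT leg of `A` are thus obtained without
  -- any operator acting on that leg.
  have h2 : ∀ i n, tmul (N.A.fill k (e i)) n ∈ L := fun i n => by
    have h3 := hY (InnerProductSpace.rankOne ℂ n (N.Ac.fill k (f i))) _ h1
    rw [map_sum] at h3
    simp only [ampLeft_tmul, InnerProductSpace.rankOne_apply, LinearIsometry.inner_map_map,
      f.inner_eq_ite, ite_smul, one_smul, zero_smul] at h3
    rw [Finset.sum_eq_single i (fun j _ hj => by rw [if_neg hj.symm, tmul_zero])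
      (fun h => (h (Finset.mem_univ i)).elim), if_pos rfl] at h3
    exact h3
  -- Rank-one operators on the auxiliary and bulk legs, which commute with the RT leg, exchange the
  -- unit reference vectors for arbitrary ones.
  have h3 : ∀ b a i n, tmul (tmul b (tmul a (e i))) n ∈ L := fun b a i n => by
    have h4 := hX _ (N.A.commute_anc_rtNew k (InnerProductSpace.rankOne ℂ a (N.A.ancState k)))
      _ (h2 i n)
    rw [Wedge.fill_apply, ampRight_tmul, ampLeft_tmul, ampRight_tmul,
      InnerProductSpace.rankOne_apply, inner_self_eq_norm_sq_to_K, N.A.norm_ancState] at h4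
    have h5 := hX _ (N.A.commute_bulk_rtNew k (InnerProductSpace.rankOne ℂ b (N.A.bulkState k)))
      _ h4
    rw [ampRight_tmul, ampRight_tmul,
      InnerProductSpace.rankOne_apply, inner_self_eq_norm_sq_to_K, N.A.norm_bulkState] at h5
    simpa using h5
  have h4 : ∀ b a c n, tmul (tmul b (tmul a c)) n ∈ L := fun b a c n => by
    have h5 : tmul (tmul b (tmul a c)) n =
        ∑ i, inner ℂ (e i) c • tmul (tmul b (tmul a (e i))) n := by
      conv_lhs => rw [← e.sum_repr' c, ← tmulLinear_apply a, map_sum, ← tmulLinear_apply b,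
        map_sum]
      have h6 := map_sum (TensorProduct.mk ℂ (N.A.New k) (N.Ac.New k) |>.flip n)
        (fun i => tmul b (tmul a (inner ℂ (e i) c • e i))) Finset.univ
      refine h6.trans (Finset.sum_congr rfl fun i _ => ?_)
      rw [tmul_smul, tmul_smul]
      exact smul_tmul _ _ _
    rw [h5]
    exact sum_mem fun i _ => L.smul_mem _ (h3 b a i n)
  induction θ using tensor_induction with
  | zero => exact zero_mem _
  | add x y hx hy => exact add_mem hx hy
  | tmul x n =>
    induction x using tensor_induction with
    | zero => rw [zero_tmul]; exact zero_mem _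
    | add x y hx hy => rw [add_tmul]; exact add_mem hx hy
    | tmul b x =>
      induction x using tensor_induction with
      | zero => rw [tmul_zero, zero_tmul]; exact zero_mem _
      | add x y hx hy => rw [tmul_add, add_tmul]; exact add_mem hx hy
      | tmul a c => exact h4 b a c n

end NewState

/-! ### Embedding the new degrees of freedom of a layer -/

/-- `θ ↦ U_A U_{Ac} θ` on the degrees of freedom of layer `0`. -/
noncomputable def embedZero : (N.A.New 0 ⊠ N.Ac.New 0 : FinHilb.{u}) →ₗ[ℂ] N.Bdy 0 :=
  (congrIsometry N.A.U₀ N.Ac.U₀).toLinearEquiv.toLinearMap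

theorem embedZero_apply (θ : (N.A.New 0 ⊠ N.Ac.New 0 : FinHilb.{u})) :
    N.embedZero θ = congrIsometry N.A.U₀ N.Ac.U₀ θ := rfl

/-- `θ ↦ U_A U_{Ac} (ψ ⊗ θ)` on the degrees of freedom added by layer `k + 1`. -/
noncomputable def embedSucc (k : ℕ) (ψ : N.Bdy k) :
    (N.A.New (k + 1) ⊠ N.Ac.New (k + 1) : FinHilb.{u}) →ₗ[ℂ] N.Bdy (k + 1) :=
  (((exchange (N.A.bdy k) (N.Ac.bdy k) (N.A.New (k + 1)) (N.Ac.New (k + 1))).trans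
    (congrIsometry (N.A.U k) (N.Ac.U k))).toLinearEquiv.toLinearMap).comp (tmulLinear ψ)

theorem embedSucc_apply (k : ℕ) (ψ : N.Bdy k)
    (θ : (N.A.New (k + 1) ⊠ N.Ac.New (k + 1) : FinHilb.{u})) :
    N.embedSucc k ψ θ = congrIsometry (N.A.U k) (N.Ac.U k)
      (exchange (N.A.bdy k) (N.Ac.bdy k) (N.A.New (k + 1)) (N.Ac.New (k + 1)) (tmul ψ θ)) := rfl

theorem embedSucc_newState (k : ℕ) (ψ : N.Bdy k) :
    N.embedSucc k ψ (N.newState (k + 1)) = N.step k ψ := rfl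

/-- A map of the new degrees of freedom into layer `k` that intertwines the operators on both
sides. -/
def IsEmbedding (k : ℕ) (J : (N.A.New k ⊠ N.Ac.New k : FinHilb.{u}) →ₗ[ℂ] N.Bdy k) : Prop :=
  (∀ X θ, ampRight (N.A.bdy k) (N.Ac.bdy k) (N.A.newOp k X) (J θ) =
      J (ampRight (N.A.New k) (N.Ac.New k) X θ)) ∧
    ∀ Y θ, ampLeft (N.A.bdy k) (N.Ac.bdy k) (N.Ac.newOp k Y) (J θ) =
      J (ampLeft (N.A.New k) (N.Ac.New k) Y θ)

theorem isEmbedding_zero : N.IsEmbedding 0 N.embedZero := by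
  constructor <;> intro X θ <;> induction θ using tensor_induction with
  | zero => simp only [map_zero]
  | add x y hx hy => simp only [map_add, hx, hy]
  | tmul x y =>
    simp only [embedZero_apply, congrIsometry_tmul, ampRight_tmul, ampLeft_tmul,
      Wedge.newOp_zero_apply]

theorem isEmbedding_succ (k : ℕ) (ψ : N.Bdy k) : N.IsEmbedding (k + 1) (N.embedSucc k ψ) := by
  constructor <;> intro X θ <;> induction θ using tensor_induction with
  | zero => simp only [map_zero]
  | add x y hx hy => simp only [map_add, hx, hy]
  | tmul x y =>
    simp only [embedSucc_apply, ampRight_tmul, ampLeft_tmul]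
    induction ψ using tensor_induction with
    | zero => simp only [zero_tmul, map_zero]
    | add a b ha hb => simp only [add_tmul, map_add, ha, hb]
    | tmul a b =>
      simp only [exchange_tmul, congrIsometry_tmul, ampRight_tmul, ampLeft_tmul,
        Wedge.newOp_succ_apply]

theorem exists_isEmbedding_state (k : ℕ) :
    ∃ J, N.IsEmbedding k J ∧ J (N.newState k) = N.state k := by
  cases k with
  | zero => exact ⟨_, N.isEmbedding_zero, rfl⟩
  | succ k => exact ⟨_, N.isEmbedding_succ k (N.state k), rfl⟩

/-! ### Operators on the limit space -/

theorem push_step_compl (Λ : ℕ) (O : N.Ac.bdy Λ →L[ℂ] N.Ac.bdy Λ) (ψ : N.Bdy Λ) :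
    ampLeft (N.A.bdy (Λ + 1)) (N.Ac.bdy (Λ + 1)) (N.Ac.push Λ O) (N.step Λ ψ) =
      N.step Λ (ampLeft (N.A.bdy Λ) (N.Ac.bdy Λ) O ψ) := by
  rw [N.step_apply, N.step_apply]
  induction N.newState (Λ + 1) using tensor_induction with
  | zero => simp only [tmul_zero, map_zero]
  | add x y hx hy => simp only [tmul_add, map_add, hx, hy]
  | tmul c d =>
    induction ψ using tensor_induction with
    | zero => simp only [zero_tmul, map_zero]
    | add x y hx hy => simp only [add_tmul, map_add, hx, hy]
    | tmul a b =>
      rw [exchange_tmul, congrIsometry_tmul, ampLeft_tmul, ampLeft_tmul, exchange_tmul,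
        congrIsometry_tmul, Wedge.push_apply, ampRight_tmul]

/-- The inductive system of the algebras `B(H_{Ac}^Λ)`, acting on `H^Λ` as `1 ⊗ O`. -/
noncomputable def complSystem : RepSystem N.step (fun Λ => N.Ac.bdy Λ →L[ℂ] N.Ac.bdy Λ) where
  φ := N.Ac.push
  ρ Λ := ampLeft (N.A.bdy Λ) (N.Ac.bdy Λ)
  compat := N.push_step_compl

theorem commute_repSystem_complSystem (k l : ℕ) (b : N.A.bdy k →L[ℂ] N.A.bdy k)
    (c : N.Ac.bdy l →L[ℂ] N.Ac.bdy l) :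
    Commute (N.repSystem.limitRep k b) (N.complSystem.limitRep l c) :=
  N.repSystem.commute_limitRep N.complSystem (fun _ b c => commute_ampRight_ampLeft b c) k l b c

/-- Push `b` to the layer just below that of `Y`, and then once more: it becomes an operator on the
old boundary, while `Y` acts on the new legs. -/
theorem commute_limitRep_newOp {k l : ℕ} (hkl : k < l) (b : N.A.bdy k →L[ℂ] N.A.bdy k)
    (Y : N.A.New l →L[ℂ] N.A.New l) :
    Commute (N.repSystem.limitRep k b) (N.repSystem.limitRep l (N.A.newOp l Y)) := by
  obtain ⟨l, rfl⟩ := Nat.exists_eq_succ_of_ne_zero (Nat.ne_zero_of_lt hkl)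
  have hk : k ≤ l := Nat.lt_succ_iff.1 hkl
  rw [← N.repSystem.limitRep_multiPush k l hk, ← N.repSystem.limitRep_push]
  exact (N.A.commute_push_newOp l _ Y).map (N.repSystem.limitRep (l + 1))

/-- The operators on the RT leg of layer `k`, represented on the limit space. -/
noncomputable def leg (k : ℕ) :
    (N.A.rt k →L[ℂ] N.A.rt k) →⋆ₐ[ℂ] (N.LimitSpace →L[ℂ] N.LimitSpace) :=
  (N.repSystem.limitRep k).comp ((N.A.newOp k).comp (N.A.rtNew k))

theorem leg_apply (k : ℕ) (R : N.A.rt k →L[ℂ] N.A.rt k) :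
    N.leg k R = N.repSystem.limitRep k (N.A.newOp k (N.A.rtNew k R)) := rfl

theorem commute_leg (k l : ℕ) (hkl : k ≠ l) (a : N.A.rt k →L[ℂ] N.A.rt k)
    (b : N.A.rt l →L[ℂ] N.A.rt l) : Commute (N.leg k a) (N.leg l b) := by
  rcases lt_or_gt_of_ne hkl with h | h
  · exact N.commute_limitRep_newOp h _ _
  · exact (N.commute_limitRep_newOp h _ _).symm

/-- In the limit a pushed operator is the same operator, so the recursive part of the RT algebra
adds nothing beyond the individual legs. -/
theorem iSup_map_rtAlgebra :
    ⨆ Λ, (N.A.rtAlgebra Λ).map (N.repSystem.limitRep Λ) = ⨆ k, (N.leg k).range := by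
  refine le_antisymm (iSup_le fun Λ => ?_) (iSup_le fun k => le_iSup_of_le k ?_)
  · induction Λ with
    | zero =>
      refine le_iSup_of_le 0 ?_
      rw [Wedge.rtAlgebra_zero]
      rintro _ ⟨_, ⟨R, rfl⟩, rfl⟩
      exact ⟨R, rfl⟩
    | succ k ih =>
      rw [Wedge.rtAlgebra_succ, StarSubalgebra.map_sup]
      refine sup_le ?_ (le_iSup_of_le (k + 1) ?_)
      · refine le_trans ?_ ih
        rintro _ ⟨_, ⟨b, hb, rfl⟩, rfl⟩
        exact ⟨b, hb, (N.repSystem.limitRep_push k b).symm⟩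
      · rintro _ ⟨_, ⟨R, rfl⟩, rfl⟩
        exact ⟨R, rfl⟩
  · rintro _ ⟨R, rfl⟩
    refine ⟨N.A.newOp k (N.A.rtNew k R), ?_, rfl⟩
    cases k with
    | zero => exact ⟨R, rfl⟩
    | succ k => exact StarSubalgebra.mem_sup_right ⟨R, rfl⟩

/-- The commutant of the RT algebra on the limit space. -/
noncomputable abbrev rtCommutant : StarSubalgebra ℂ (N.LimitSpace →L[ℂ] N.LimitSpace) :=
  StarSubalgebra.centralizer ℂ
    ((⨆ k, (N.leg k).range : StarSubalgebra ℂ (N.LimitSpace →L[ℂ] N.LimitSpace)) :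
      Set (N.LimitSpace →L[ℂ] N.LimitSpace))

/-- The leg ranges are closed under adjoints, so `T` and `star T` both commute with all the
generators and therefore with the algebra they generate. -/
theorem mem_rtCommutant {T : N.LimitSpace →L[ℂ] N.LimitSpace}
    (hT : ∀ k R, Commute (N.leg k R) T) : T ∈ N.rtCommutant := by
  have hT' : ∀ k R, Commute (N.leg k R) (star T) := fun k R => by
    have := (hT k (star R)).star_star
    rwa [← map_star, star_star] at this
  have h : (⨆ k, (N.leg k).range) ≤ StarSubalgebra.centralizer ℂ {T} := iSup_le fun k => by
    rintro _ ⟨R, rfl⟩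
    refine (StarSubalgebra.mem_centralizer_iff ℂ).2 ?_
    rintro _ rfl
    exact ⟨(hT k R).eq.symm, (hT' k R).eq.symm⟩
  exact mem_centralizer_coe.2 fun x hx =>
    ((StarSubalgebra.mem_centralizer_iff ℂ).1 (h hx) T rfl).1.symm

theorem complSystem_mem_rtCommutant (k : ℕ) (c : N.Ac.bdy k →L[ℂ] N.Ac.bdy k) :
    N.complSystem.limitRep k c ∈ N.rtCommutant :=
  N.mem_rtCommutant fun l _ => N.commute_repSystem_complSystem l k _ c

theorem newOp_mem_rtCommutant (k : ℕ) {X : N.A.New k →L[ℂ] N.A.New k}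
    (hX : ∀ R, Commute X (N.A.rtNew k R)) :
    N.repSystem.limitRep k (N.A.newOp k X) ∈ N.rtCommutant := by
  refine N.mem_rtCommutant fun l R => ?_
  rcases lt_trichotomy l k with h | rfl | h
  · exact N.commute_limitRep_newOp h _ _
  · exact (((hX _).symm.map (N.A.newOp l)).map (N.repSystem.limitRep l))
  · exact (N.commute_limitRep_newOp h _ _).symm

theorem limitRep_newOp_of {k : ℕ} {J} (hJ : N.IsEmbedding k J) (X : N.A.New k →L[ℂ] N.A.New k)
    (θ : (N.A.New k ⊠ N.Ac.New k : FinHilb.{u})) :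
    N.repSystem.limitRep k (N.A.newOp k X) (HilbertLimit.of N.step k (J θ)) =
      HilbertLimit.of N.step k (J (ampRight (N.A.New k) (N.Ac.New k) X θ)) := by
  rw [N.repSystem.limitRep_of k k le_rfl, multiPush_self, ← hJ.1]
  rfl

theorem complSystem_newOp_of {k : ℕ} {J} (hJ : N.IsEmbedding k J)
    (Y : N.Ac.New k →L[ℂ] N.Ac.New k) (θ : (N.A.New k ⊠ N.Ac.New k : FinHilb.{u})) :
    N.complSystem.limitRep k (N.Ac.newOp k Y) (HilbertLimit.of N.step k (J θ)) =
      HilbertLimit.of N.step k (J (ampLeft (N.A.New k) (N.Ac.New k) Y θ)) := by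
  rw [N.complSystem.limitRep_of k k le_rfl, multiPush_self, ← hJ.2]
  rfl

/-- The limit state can be represented at layer `k`, where it is the image of the new-leg state
under a map intertwining both sides; the transpose on the complement carries over. -/
theorem exists_reflection_leg (k : ℕ) (R : N.A.rt k →L[ℂ] N.A.rt k) :
    ∃ y ∈ N.rtCommutant, N.leg k R N.limitState = y N.limitState ∧
      star (N.leg k R) N.limitState = star y N.limitState := by
  obtain ⟨J, hJ, hs⟩ := N.exists_isEmbedding_state k
  obtain ⟨Y, h1, h2⟩ := N.exists_reflection_newState k R
  refine ⟨_, N.complSystem_mem_rtCommutant k (N.Ac.newOp k Y), ?_, ?_⟩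
  · rw [N.limitState_eq k, ← hs, leg_apply, N.limitRep_newOp_of hJ, h1,
      N.complSystem_newOp_of hJ]
  · rw [← map_star, ← map_star, ← map_star, N.limitState_eq k, ← hs, leg_apply,
      N.limitRep_newOp_of hJ, h2, N.complSystem_newOp_of hJ]

theorem of_embedding_mem {k : ℕ} {J} (hJ : N.IsEmbedding k J) (L : Submodule ℂ N.LimitSpace)
    (hL : ∀ T ∈ N.rtCommutant, ∀ ξ ∈ L, T ξ ∈ L)
    (h0 : HilbertLimit.of N.step k (J (N.newState k)) ∈ L)
    (θ : (N.A.New k ⊠ N.Ac.New k : FinHilb.{u})) : HilbertLimit.of N.step k (J θ) ∈ L := by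
  refine N.newState_cyclic k (L.comap ((HilbertLimit.of N.step k).toLinearMap ∘ₗ J)) h0
    (fun X hX θ hθ => ?_) (fun Y θ hθ => ?_) θ
  · change HilbertLimit.of N.step k _ ∈ L
    rw [← N.limitRep_newOp_of hJ]
    exact hL _ (N.newOp_mem_rtCommutant k hX) _ hθ
  · change HilbertLimit.of N.step k _ ∈ L
    rw [← N.complSystem_newOp_of hJ]
    exact hL _ (N.complSystem_mem_rtCommutant k _) _ hθ

/-- Induction on layers. For a product vector `ψ ⊗ θ` at layer `k + 1`, the vector with `θ` replaced
by the reference state is the class of `ψ`, already in `L`; cyclicity in the new legs then reaches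
every `θ`. -/
theorem of_mem (L : Submodule ℂ N.LimitSpace)
    (hL : ∀ T ∈ N.rtCommutant, ∀ ξ ∈ L, T ξ ∈ L) (h0 : N.limitState ∈ L) (k : ℕ)
    (ψ : N.Bdy k) : HilbertLimit.of N.step k ψ ∈ L := by
  induction k with
  | zero =>
    obtain ⟨θ, rfl⟩ := (congrIsometry N.A.U₀ N.Ac.U₀).surjective ψ
    exact N.of_embedding_mem N.isEmbedding_zero L hL h0 θ
  | succ k ih =>
    obtain ⟨z, rfl⟩ := ((exchange (N.A.bdy k) (N.Ac.bdy k) (N.A.New (k + 1))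
      (N.Ac.New (k + 1))).trans (congrIsometry (N.A.U k) (N.Ac.U k))).surjective ψ
    induction z using tensor_induction with
    | zero => rw [map_zero, map_zero]; exact zero_mem _
    | add x y hx hy => rw [map_add, map_add]; exact add_mem hx hy
    | tmul ψ θ =>
      refine N.of_embedding_mem (N.isEmbedding_succ k ψ) L hL ?_ θ
      rw [embedSucc_newState, HilbertLimit.of_step]
      exact ih ψ

theorem dense_rtCommutant_limitState :
    Dense {ξ | ∃ y ∈ N.rtCommutant, y N.limitState = ξ} := by
  let L : Submodule ℂ N.LimitSpace := N.rtCommutant.toSubalgebra.toSubmodule.map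
    (ContinuousLinearMap.apply ℂ N.LimitSpace N.limitState).toLinearMap
  have hL : ∀ T ∈ N.rtCommutant, ∀ ξ ∈ L, T ξ ∈ L := by
    rintro T hT _ ⟨y, hy, rfl⟩
    exact ⟨T * y, mul_mem (S := StarSubalgebra ℂ _) hT hy, rfl⟩
  have h0 : N.limitState ∈ L := ⟨1, one_mem N.rtCommutant, rfl⟩
  refine (UniformSpace.Completion.denseRange_coe (α := PreHilbertLimit N.step)).mono ?_
  rintro _ ⟨z, rfl⟩
  induction z using PreHilbertLimit.induction with
  | h n x => exact N.of_mem L hL h0 n x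

theorem norm_state (k : ℕ) : ‖N.state k‖ = 1 := by
  induction k with
  | zero => exact ((congrIsometry N.A.U₀ N.Ac.U₀).norm_map _).trans (N.norm_newState 0)
  | succ k ih => exact ((N.step k).norm_map _).trans ih

theorem isReflectingVector_limitState :
    IsReflectingVector (⨆ k, (N.leg k).range) N.limitState where
  norm_eq_one := ((HilbertLimit.of N.step 0).norm_map _).trans (N.norm_state 0)
  cyclic := N.dense_rtCommutant_limitState
  reflect x hx := by
    -- The reflectible elements form a `*`-subalgebra, so it suffices to reflect the single legs.
    have h : (⨆ k, (N.leg k).range) ≤ reflectible (⨆ k, (N.leg k).range) N.limitState :=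
      iSup_le fun k => by
        rintro _ ⟨R, rfl⟩
        exact ⟨le_iSup (fun k => (N.leg k).range) k ⟨R, rfl⟩, N.exists_reflection_leg k R⟩
    exact (h hx).2

theorem rtVonNeumann_eq : N.rtVonNeumann = bicommutant (⨆ k, (N.leg k).range) := by
  rw [rtVonNeumann, rtCStarAlgebra, bicommutant_topologicalClosure, iSup_map_rtAlgebra]

theorem rtCStarAlgebra_le :
    N.rtCStarAlgebra ≤ (bicommutant (⨆ k, (N.leg k).range)).toStarSubalgebra := by
  rw [rtCStarAlgebra, iSup_map_rtAlgebra]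
  exact topologicalClosure_le_bicommutant _

end HolographicNetwork

theorem theorem1 (N : HolographicNetwork.{u})
    (hRT : ∃ᶠ Λ in Filter.atTop, 2 ≤ Module.finrank ℂ (N.A.rt Λ)) :
    IsTypeIIOne N.rtVonNeumann ∧ IsFactor N.rtVonNeumann ∧
      IsTracialState (vectorFunctional N.limitState N.rtCStarAlgebra) ∧
      IsTracialState (vectorFunctional N.limitState N.rtVonNeumann.toStarSubalgebra) ∧
      IsNormalFunctional (vectorFunctional N.limitState N.rtVonNeumann.toStarSubalgebra) := by
  have h := N.isReflectingVector_limitState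
  refine ⟨?_, ?_, h.isTracialState N.rtCStarAlgebra_le, h.isTracialState ?_,
    isNormalFunctional_vectorFunctional _ _⟩
  · rw [N.rtVonNeumann_eq]
    exact h.isTypeIIOne N.commute_leg hRT
  · rw [N.rtVonNeumann_eq]
    exact h.isFactor N.commute_leg
  · rw [N.rtVonNeumann_eq]
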